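/- Let $\nu,\lambda_+,\lambda_-,\lambda_0>0$ and $D^{\pm}=\partial_x\pm i\partial_y$ on $\mathbb{R}^2$. For $u_\pm\in H^1(\mathbb{R}^2)=H^1(\mathbb{R}^2;\mathbb{C})$ put $$M(u_+,u_-)=\|u_+\|_{L^2}^2+\|u_-\|_{L^2}^2,$$ $$E^{\mathrm{lin}}(u_+,u_-)=\frac14\int_{\mathbb{R}^2}\big(|D^+u_+|^2+|D^-u_-|^2\big)\,dz+\frac{\nu}{2}\,\mathrm{Re}\int_{\mathbb{R}^2}\big(\overline{u_+}\,D^-u_--\overline{u_-}\,D^+u_+\big)\,dz,$$ $$N(u_+,u_-)=\frac14\int_{\mathbb{R}^2}\big(\lambda_+|u_+|^4+\lambda_-|u_-|^4+2\lambda_0|u_+|^2|u_-|^2\big)\,dz,\qquad E=E^{\mathrm{lin}}-N,$$ and for $\rho>0$ let $\mathcal{E}(\rho)$ and $\mathcal{E}^{\mathrm{lin}}(\rho)$ be the infima in $[-\infty,\infty]$ of $E$ and of $E^{\mathrm{lin}}$, respectively, over all $(u_+,u_-)\in H^1(\mathbb{R}^2)\times H^1(\mathbb{R}^2)$ with $M(u_+,u_-)=\rho$.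 For $l\in\mathbb{Z}$ let $H_l$ be the space of measurable $f\colon(0,\infty)\to\mathbb{C}$ with weak derivative $f'$ such that $f$, $f'$, $\frac{l}{r}f\in L^2((0,\infty);r\,dr)$. For $m\in\mathbb{Z}$ and $(v_+,v_-)\in H_m\times H_{m+1}$ put $$M(v_+,v_-)=\int_0^\infty(|v_+|^2+|v_-|^2)\,r\,dr,$$ $$E_m^{\mathrm{lin}}(v_+,v_-)=\frac14\int_0^\infty\Big(|v_+'|^2+\frac{m^2}{r^2}|v_+|^2+|v_-'|^2+\frac{(m+1)^2}{r^2}|v_-|^2\Big)r\,dr+\frac{\nu}{2}\,\mathrm{Re}\int_0^\infty\Big\{\Big(v_-'+\frac{m+1}{r}v_-\Big)\overline{v_+}-\Big(v_+'-\frac{m}{r}v_+\Big)\overline{v_-}\Big\}\,r\,dr,$$ $$E_m(v_+,v_-)=E_m^{\mathrm{lin}}(v_+,v_-)-\frac14\int_0^\infty\big(\lambda_+|v_+|^4+\lambda_-|v_-|^4+2\lambda_0|v_+|^2|v_-|^2\big)\,r\,dr,$$ and let $\mathcal{E}_m(\rho)$ and $\mathcal{E}_m^{\mathrm{lin}}(\rho)$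 be the infima in $[-\infty,\infty]$ of $E_m$ and of $E_m^{\mathrm{lin}}$, respectively, over all $(v_+,v_-)\in H_m\times H_{m+1}$ with $M(v_+,v_-)=\rho$. Then for every $\rho>0$ $$\mathcal{E}(\rho)<\mathcal{E}^{\mathrm{lin}}(\rho),\qquad\text{and}\qquad \mathcal{E}_m(\rho)<\mathcal{E}_m^{\mathrm{lin}}(\rho)\quad\text{for every } m\in\mathbb{Z}.$$ -/

import Mathlib

open MeasureTheory Set
open scoped ComplexConjugate

namespace SpinOrbit

noncomputable section

/-! ### The Sobolev space `H¹(ℝ²)`, with `ℝ² = ℝ × ℝ` and Lebesgue measure -/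

/-- `g` is the weak partial derivative of `u` on `ℝ²` in the direction `e`. -/
def IsWeakPartial (e : ℝ × ℝ) (u g : ℝ × ℝ → ℂ) : Prop :=
  ∀ φ : ℝ × ℝ → ℝ, ContDiff ℝ (⊤ : ℕ∞) φ → HasCompactSupport φ →
    ∫ z, (fderiv ℝ φ z e) • u z = -∫ z, φ z • g z

/-- An element of `H¹(ℝ²)`: a complex function in `L²` together with its weak partial derivatives
in `L²`. Those are determined almost everywhere by the function, so they are no extra choice. -/
structure H1 where
  /-- the function itself -/
  toFun : ℝ × ℝ → ℂ
  /-- the weak derivative `∂ₓ` -/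
  dx : ℝ × ℝ → ℂ
  /-- the weak derivative `∂_y` -/
  dy : ℝ × ℝ → ℂ
  memLp_toFun : MemLp toFun 2 volume
  memLp_dx : MemLp dx 2 volume
  memLp_dy : MemLp dy 2 volume
  isWeakPartial_dx : IsWeakPartial (1, 0) toFun dx
  isWeakPartial_dy : IsWeakPartial (0, 1) toFun dy

instance : CoeFun H1 (fun _ => ℝ × ℝ → ℂ) := ⟨H1.toFun⟩

/-- `D⁺ u = ∂ₓ u + i ∂_y u`. -/
def H1.Dplus (u : H1) (z : ℝ × ℝ) : ℂ := u.dx z + Complex.I * u.dy z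

/-- `D⁻ u = ∂ₓ u - i ∂_y u`. -/
def H1.Dminus (u : H1) (z : ℝ × ℝ) : ℂ := u.dx z - Complex.I * u.dy z

/-! ### Mass, energy and the constrained infima on `H¹(ℝ²) × H¹(ℝ²)`

The argument `ν` is the spin-orbit coefficient; `lp`, `lm`, `l0` are the nonlinear coefficients
`λ₊`, `λ₋`, `λ₀`; `p` and `q` are the components `u₊` and `u₋`. -/

/-- The mass `M`. -/
def mass (p q : H1) : ℝ := (∫ z, ‖p z‖ ^ 2) + ∫ z, ‖q z‖ ^ 2

/-- The kinetic energy. -/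
def kinetic (p q : H1) : ℝ := (1 / 4) * ∫ z, (‖p.Dplus z‖ ^ 2 + ‖q.Dminus z‖ ^ 2)

/-- The spin-orbit energy `V_SO`. -/
def spinOrbit (ν : ℝ) (p q : H1) : ℝ :=
  (ν / 2) * (∫ z, (conj (p z) * q.Dminus z - conj (q z) * p.Dplus z)).re

/-- The quartic functional `N`. -/
def quartic (lp lm l0 : ℝ) (p q : H1) : ℝ :=
  (1 / 4) * ∫ z, (lp * ‖p z‖ ^ 4 + lm * ‖q z‖ ^ 4 + 2 * l0 * ‖p z‖ ^ 2 * ‖q z‖ ^ 2)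

/-- The energy `E`. -/
def energy (ν lp lm l0 : ℝ) (p q : H1) : ℝ :=
  kinetic p q + spinOrbit ν p q - quartic lp lm l0 p q

/-- The linear energy `E^lin`: the energy without its quartic term. -/
def energyLin (ν : ℝ) (p q : H1) : ℝ := kinetic p q + spinOrbit ν p q

/-- `𝓔(ρ)`, as an extended real number, because it is `-∞` when the energy is unbounded below. -/
def infEnergy (ν lp lm l0 ρ : ℝ) : EReal :=
  sInf {e : EReal | ∃ p q : H1, mass p q = ρ ∧ e = (energy ν lp lm l0 p q : EReal)}

/-- `𝓔^lin(ρ)`. -/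
def infEnergyLin (ν ρ : ℝ) : EReal :=
  sInf {e : EReal | ∃ p q : H1, mass p q = ρ ∧ e = (energyLin ν p q : EReal)}

/-! ### The radial problem for semi-vortices of index `m` -/

/-- The measure `r dr` on `(0, ∞)`. -/
def radialMeasure : Measure ℝ :=
  (volume.restrict (Ioi (0 : ℝ))).withDensity (fun r => ENNReal.ofReal r)

/-- `g` is the weak derivative of `f` on the open half-line `(0, ∞)`. -/
def IsWeakDerivIoi (f g : ℝ → ℂ) : Prop :=
  ∀ φ : ℝ → ℝ, ContDiff ℝ (⊤ : ℕ∞) φ → HasCompactSupport φ → tsupport φ ⊆ Ioi 0 →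
    ∫ r in Ioi (0 : ℝ), (deriv φ r) • f r = -∫ r in Ioi (0 : ℝ), φ r • g r

/-- An element of `H_l`: a function `f` on `(0, ∞)` with `f`, `f'` and `(l / r) f` in `L²(r dr)`,
together with its weak derivative `f'`. Only the values on `(0, ∞)` matter. -/
structure HRad (l : ℤ) where
  /-- the function itself -/
  toFun : ℝ → ℂ
  /-- the weak derivative -/
  dr : ℝ → ℂ
  memLp_toFun : MemLp toFun 2 radialMeasure
  memLp_dr : MemLp dr 2 radialMeasure
  memLp_div : MemLp (fun r : ℝ => ((l : ℂ) / (r : ℂ)) * toFun r) 2 radialMeasure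
  isWeakDeriv : IsWeakDerivIoi toFun dr

instance (l : ℤ) : CoeFun (HRad l) (fun _ => ℝ → ℂ) := ⟨HRad.toFun⟩

/-- `r^{-l} (r^l f)' = f' + (l / r) f`. -/
def HRad.raise {l : ℤ} (f : HRad l) (r : ℝ) : ℂ := f.dr r + ((l : ℂ) / (r : ℂ)) * f r

/-- `r^l (r^{-l} f)' = f' - (l / r) f`. -/
def HRad.lower {l : ℤ} (f : HRad l) (r : ℝ) : ℂ := f.dr r - ((l : ℂ) / (r : ℂ)) * f r

/-- The radial mass. -/
def massRad {m : ℤ} (p : HRad m) (q : HRad (m + 1)) : ℝ :=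
  ∫ r, (‖p r‖ ^ 2 + ‖q r‖ ^ 2) ∂radialMeasure

/-- The radial kinetic energy. -/
def kineticRad {m : ℤ} (p : HRad m) (q : HRad (m + 1)) : ℝ :=
  (1 / 4) * ∫ r, (‖p.dr r‖ ^ 2 + (m : ℝ) ^ 2 / r ^ 2 * ‖p r‖ ^ 2
    + ‖q.dr r‖ ^ 2 + ((m : ℝ) + 1) ^ 2 / r ^ 2 * ‖q r‖ ^ 2) ∂radialMeasure

/-- The radial spin-orbit energy. -/
def spinOrbitRad (ν : ℝ) {m : ℤ} (p : HRad m) (q : HRad (m + 1)) : ℝ :=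
  (ν / 2) * (∫ r, (q.raise r * conj (p r) - p.lower r * conj (q r)) ∂radialMeasure).re

/-- The radial quartic functional. -/
def quarticRad (lp lm l0 : ℝ) {m : ℤ} (p : HRad m) (q : HRad (m + 1)) : ℝ :=
  (1 / 4) * ∫ r, (lp * ‖p r‖ ^ 4 + lm * ‖q r‖ ^ 4 + 2 * l0 * ‖p r‖ ^ 2 * ‖q r‖ ^ 2) ∂radialMeasure

/-- The energy `E_m`. -/
def energyRad (ν lp lm l0 : ℝ) {m : ℤ} (p : HRad m) (q : HRad (m + 1)) : ℝ :=
  kineticRad p q + spinOrbitRad ν p q - quarticRad lp lm l0 p q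

/-- The linear energy `E_m^lin`. -/
def energyLinRad (ν : ℝ) {m : ℤ} (p : HRad m) (q : HRad (m + 1)) : ℝ :=
  kineticRad p q + spinOrbitRad ν p q

/-- `𝓔_m(ρ)`. -/
def infEnergyRad (m : ℤ) (ν lp lm l0 ρ : ℝ) : EReal :=
  sInf {e : EReal | ∃ (p : HRad m) (q : HRad (m + 1)), massRad p q = ρ ∧
    e = (energyRad ν lp lm l0 p q : EReal)}

/-- `𝓔_m^lin(ρ)`. -/
def infEnergyLinRad (m : ℤ) (ν ρ : ℝ) : EReal :=
  sInf {e : EReal | ∃ (p : HRad m) (q : HRad (m + 1)), massRad p q = ρ ∧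
    e = (energyLinRad ν p q : EReal)}

end

end SpinOrbit

open Filter Topology

namespace SpinOrbit

/-! ### Weak derivatives on the half-line -/

/-! Completing the square turns the linear energy into `E^lin = D/4 - (ν²/4) M`. Here `D ≥ 0` is the
squared `L²` defect in the first-order system `D⁻u₋ = -ν u₊`, `D⁺u₊ = ν u₋`, or in its radial form.
Hence the linear infimum is at least `-ν²ρ/4`, and it suffices to find one pair of mass `ρ` whose
full energy lies strictly below this value. Multiplying a pair by `t` with `t² = ρ/M` scales `D` by
`t²` and the quartic term `N` by `t⁴`, so any pair with `M > 0` and `D M < 4 N ρ` will do. The task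
is to make `D M / N` arbitrarily small.

Exact solutions of the system have `D = 0` but infinite mass, so they are truncated. In the plane,
cut `e^{iνx}` off on a box of sides of order `R × S` and set `u₋ = D⁺u₊/ν`. The second equation is
then exact, and the first has defect `(Δu₊ + ν²u₊)/ν = O(1/R + 1/S²)`. A box with `R = S` would
leave `D M / N` merely bounded. With `R = n²` and `S = n` the defect is `O(n⁻²)`, so `D M = O(n²)`,
while `N` is at least of order `n³`.

For index `m` the solutions are Bessel functions of orders `m` and `m + 1`. The density `r (p² +
q²)` of a nontrivial solution stays between positive constants near infinity. A cutoff at radius `R`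
therefore gives `D = O(1/R)` and `M = O(R)`, and `N` is at least a multiple of `∫ dr / r`, which
grows like `log R`. The product `D M` stays bounded and `N` does not.

The one delicate point in the radial square is that the kinetic energy equals the squared norms of
`q' + ((m+1)/r) q` and `p' - (m/r) p`. This needs `Re ∫ f' f̄ dr = 0` for every `f` in `H_l` with `l
≠ 0`, where `f` has only a weak derivative. The carriers are `integral_mul_weakDeriv_eq_zero` for
this identity, `energyLin_eq` and `energyLinRad_eq` for the squares,
`IsRadialSolution.exists_bounds_atTop` for the radial decay, and `Dminus_wavePacketSnd_add` for the
planar defect. -/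

theorem intervalIntegrable_of_locallyIntegrableOn_Ioi {g : ℝ → ℝ}
    (hg : LocallyIntegrableOn g (Ioi 0)) {a b : ℝ} (ha : 0 < a) (hb : 0 < b) :
    IntervalIntegrable g volume a b := by
  have h : uIcc a b ⊆ Ioi (0 : ℝ) := fun x hx => lt_of_lt_of_le (lt_min ha hb) hx.1
  exact (hg.integrableOn_compact_subset h isCompact_uIcc).intervalIntegrable

theorem absolutelyContinuousOnInterval_primitive {g : ℝ → ℝ}
    (hg : LocallyIntegrableOn g (Ioi 0)) (c : ℝ) {a b : ℝ} (ha : 0 < a) (hb : 0 < b) :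
    AbsolutelyContinuousOnInterval (fun x => c + ∫ t in (1 : ℝ)..x, g t) a b ∧
      ∀ᵐ x, x ∈ uIcc a b → HasDerivAt (fun x => c + ∫ t in (1 : ℝ)..x, g t) (g x) x := by
  -- The base point of the primitive is `1`, so the interval is enlarged to contain it.
  set a' := min 1 (min a b)
  set b' := max 1 (max a b)
  have ha' : 0 < a' := lt_min one_pos (lt_min ha hb)
  have hb' : 0 < b' := lt_max_of_lt_left one_pos
  have hab : a' ≤ b' := (min_le_left _ _).trans (le_max_left _ _)
  have hint := intervalIntegrable_of_locallyIntegrableOn_Ioi hg ha' hb'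
  have h1 : (1 : ℝ) ∈ uIcc a' b' := by
    rw [uIcc_of_le hab]; exact ⟨min_le_left _ _, le_max_left _ _⟩
  have hsub : uIcc a b ⊆ uIcc a' b' := by
    rw [uIcc_of_le hab]
    exact Icc_subset_Icc (min_le_right _ _) (le_max_right _ _)
  have hconst : AbsolutelyContinuousOnInterval (fun _ : ℝ => c) a' b' :=
    (LipschitzWith.const c).lipschitzOnWith.absolutelyContinuousOnInterval
  constructor
  · exact (hconst.add (hint.absolutelyContinuousOnInterval_intervalIntegral h1)).mono hsub
  · filter_upwards [hint.ae_hasDerivAt_integral] with x hx hxab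
    exact (hx (hsub hxab) 1 h1).const_add c

theorem exists_Ioo_of_tsupport_subset_Ioi {φ : ℝ → ℝ} (hc : HasCompactSupport φ)
    (hs : tsupport φ ⊆ Ioi 0) : ∃ a b, 0 < a ∧ a < b ∧ tsupport φ ⊆ Ioo a b := by
  rcases (tsupport φ).eq_empty_or_nonempty with h | h
  · exact ⟨1, 2, by norm_num, by norm_num, by simp [h]⟩
  · obtain ⟨x, hx, hmin⟩ := hc.isCompact.exists_isLeast h
    obtain ⟨y, hy, hmax⟩ := hc.isCompact.exists_isGreatest h
    have hx0 : (0 : ℝ) < x := hs hx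
    have hxy : x ≤ y := hmin hy
    refine ⟨x / 2, y + 1, by linarith, by linarith, fun z hz => ⟨?_, ?_⟩⟩
    · have := hmin hz; linarith
    · have := hmax hz; linarith

theorem setIntegral_Ioi_eq_intervalIntegral {ψ : ℝ → ℝ} {a b : ℝ} (ha : 0 < a) (hab : a < b)
    (h : ∀ x, x ∉ Ioo a b → ψ x = 0) : ∫ x in Ioi (0 : ℝ), ψ x = ∫ x in a..b, ψ x := by
  rw [intervalIntegral.integral_of_le hab.le]
  refine setIntegral_eq_of_subset_of_forall_sdiff_eq_zero measurableSet_Ioi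
    (fun x hx => ha.trans hx.1) fun x hx => h x fun hx' => hx.2 ⟨hx'.1, hx'.2.le⟩

theorem deriv_eq_zero_of_notMem_tsupport {φ : ℝ → ℝ} {x : ℝ} (hx : x ∉ tsupport φ) :
    deriv φ x = 0 := by
  by_contra h
  exact hx (support_deriv_subset h)

theorem integral_deriv_mul_primitive {g φ : ℝ → ℝ} (hg : LocallyIntegrableOn g (Ioi 0))
    (hφ : ContDiff ℝ (⊤ : ℕ∞) φ) (hc : HasCompactSupport φ) (hs : tsupport φ ⊆ Ioi 0) :
    ∫ x in Ioi (0 : ℝ), deriv φ x * (∫ t in (1 : ℝ)..x, g t) = -∫ x in Ioi (0 : ℝ), φ x * g x := by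
  obtain ⟨a, b, ha, hab, hsub⟩ := exists_Ioo_of_tsupport_subset_Ioi hc hs
  have hz : ∀ x, x ∉ Ioo a b → φ x = 0 := fun x hx =>
    image_eq_zero_of_notMem_tsupport fun h => hx (hsub h)
  have hz' : ∀ x, x ∉ Ioo a b → deriv φ x = 0 := fun x hx =>
    deriv_eq_zero_of_notMem_tsupport fun h => hx (hsub h)
  rw [setIntegral_Ioi_eq_intervalIntegral ha hab (fun x hx => by simp [hz' x hx]),
    setIntegral_Ioi_eq_intervalIntegral ha hab (fun x hx => by simp [hz x hx])]
  obtain ⟨hF, hF'⟩ := absolutelyContinuousOnInterval_primitive hg 0 ha (ha.trans hab)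
  have hφ' : AbsolutelyContinuousOnInterval φ a b :=
    ContDiffOn.absolutelyContinuousOnInterval (hφ.of_le (by exact_mod_cast le_top)).contDiffOn
  have key := hφ'.integral_mul_deriv_eq_deriv_mul hF
  simp only [zero_add, hz a (by simp), hz b (by simp), zero_mul, sub_zero, zero_sub] at key hF'
  rw [← neg_eq_iff_eq_neg, ← key]
  apply intervalIntegral.integral_congr_ae
  filter_upwards [hF'] with x hx hxm
  rw [(hx (uIoc_subset_uIcc hxm)).deriv]

theorem hasDerivAt_primitive_of_contDiff {θ : ℝ → ℝ} (hθ : ContDiff ℝ (⊤ : ℕ∞) θ) (x : ℝ) :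
    HasDerivAt (fun x => ∫ t in (0 : ℝ)..x, θ t) (θ x) x :=
  intervalIntegral.integral_hasDerivAt_right (hθ.continuous.intervalIntegrable _ _)
    hθ.continuous.aestronglyMeasurable.stronglyMeasurableAtFilter hθ.continuous.continuousAt

/-- The primitive from `0` vanishes to the left of the support of `θ`. Mean zero is exactly what
makes it vanish to the right as well. -/
theorem exists_primitive_testFunction {θ : ℝ → ℝ} (hθ : ContDiff ℝ (⊤ : ℕ∞) θ)
    (hc : HasCompactSupport θ) (hs : tsupport θ ⊆ Ioi 0) (h0 : ∫ x, θ x = 0) :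
    ∃ φ : ℝ → ℝ, ContDiff ℝ (⊤ : ℕ∞) φ ∧ HasCompactSupport φ ∧ tsupport φ ⊆ Ioi 0 ∧
      deriv φ = θ := by
  obtain ⟨a, b, ha, hab, hsub⟩ := exists_Ioo_of_tsupport_subset_Ioi hc hs
  have hz : ∀ x, x ∉ Ioo a b → θ x = 0 := fun x hx =>
    image_eq_zero_of_notMem_tsupport fun h => hx (hsub h)
  have hd : deriv (fun x => ∫ t in (0 : ℝ)..x, θ t) = θ :=
    funext fun x => (hasDerivAt_primitive_of_contDiff hθ x).deriv
  have hsupp : Function.support (fun x => ∫ t in (0 : ℝ)..x, θ t) ⊆ Icc a b := by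
    intro x hx
    by_contra hx'
    apply hx
    rw [mem_Icc, not_and_or, not_le, not_le] at hx'
    rcases hx' with h | h
    · change ∫ t in (0 : ℝ)..x, θ t = 0
      rw [intervalIntegral.integral_congr (g := fun _ => (0 : ℝ)), intervalIntegral.integral_zero]
      intro t ht
      exact hz t fun h' => absurd (ht.2.trans (max_le ha.le h.le)) (not_le.2 h'.1)
    · change ∫ t in (0 : ℝ)..x, θ t = 0
      rw [intervalIntegral.integral_of_le (ha.trans (hab.trans h)).le]
      refine Eq.trans ?_ h0
      exact setIntegral_eq_integral_of_forall_compl_eq_zero fun t ht =>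
        hz t fun h' => ht ⟨ha.trans h'.1, h'.2.le.trans h.le⟩
  have hts : tsupport (fun x => ∫ t in (0 : ℝ)..x, θ t) ⊆ Icc a b :=
    closure_minimal hsupp isClosed_Icc
  refine ⟨_, ?_, HasCompactSupport.of_support_subset_isCompact isCompact_Icc hsupp,
    hts.trans fun x hx => ha.trans_le hx.1, hd⟩
  refine contDiff_infty_iff_deriv.2 ⟨fun x =>
    (hasDerivAt_primitive_of_contDiff hθ x).differentiableAt, ?_⟩
  rw [hd]; exact hθ

theorem integrableOn_testFunction_smul {E : Type*} [NormedAddCommGroup E] [NormedSpace ℝ E]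
    {w : ℝ → E} {ψ : ℝ → ℝ} (hw : LocallyIntegrableOn w (Ioi 0))
    (hψ : Continuous ψ) (hc : HasCompactSupport ψ) (hs : tsupport ψ ⊆ Ioi 0) :
    IntegrableOn (fun x => ψ x • w x) (Ioi 0) := by
  have h1 : IntegrableOn w (tsupport ψ) := hw.integrableOn_compact_subset hs hc.isCompact
  have h2 : IntegrableOn (fun x => ψ x • w x) (tsupport ψ) :=
    h1.continuousOn_smul hψ.continuousOn hc.isCompact
  refine IntegrableOn.of_forall_sdiff_eq_zero h2 measurableSet_Ioi fun x hx => ?_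
  rw [image_eq_zero_of_notMem_tsupport hx.2, zero_smul]

theorem integrableOn_testFunction_mul {w ψ : ℝ → ℝ} (hw : LocallyIntegrableOn w (Ioi 0))
    (hψ : Continuous ψ) (hc : HasCompactSupport ψ) (hs : tsupport ψ ⊆ Ioi 0) :
    IntegrableOn (fun x => ψ x * w x) (Ioi 0) :=
  integrableOn_testFunction_smul hw hψ hc hs

/-- The du Bois-Reymond lemma on the half-line. -/
theorem exists_ae_eq_const_of_integral_deriv_mul_eq_zero {w : ℝ → ℝ}
    (hw : LocallyIntegrableOn w (Ioi 0))
    (h : ∀ φ : ℝ → ℝ, ContDiff ℝ (⊤ : ℕ∞) φ → HasCompactSupport φ → tsupport φ ⊆ Ioi 0 →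
      ∫ x in Ioi (0 : ℝ), deriv φ x * w x = 0) :
    ∃ c : ℝ, ∀ᵐ x, x ∈ Ioi (0 : ℝ) → w x = c := by
  -- Any test function of integral one would do. Centre `1` and outer radius `1/2` keep the support
  -- inside `(0, ∞)`.
  let B : ContDiffBump (1 : ℝ) := ⟨1 / 4, 1 / 2, by norm_num, by norm_num⟩
  set β : ℝ → ℝ := B.normed volume
  have hβ : ContDiff ℝ (⊤ : ℕ∞) β := B.contDiff_normed
  have hβc : HasCompactSupport β := B.hasCompactSupport_normed
  have hβs : tsupport β ⊆ Ioi 0 := by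
    rw [B.tsupport_normed_eq]
    intro x hx
    have : |x - 1| ≤ 1 / 2 := by simpa [Real.dist_eq, B] using hx
    have := (abs_le.1 this).1
    rw [mem_Ioi]; linarith
  have hβ1 : ∫ x, β x = 1 := B.integral_normed
  set c := ∫ x in Ioi (0 : ℝ), β x * w x
  refine ⟨c, ?_⟩
  have hconst : LocallyIntegrableOn (fun _ : ℝ => c) (Ioi 0) :=
    (locallyIntegrable_const c).locallyIntegrableOn _
  suffices ∀ᵐ x, x ∈ Ioi (0 : ℝ) → w x - c = 0 by
    filter_upwards [this] with x hx hx0 using sub_eq_zero.1 (hx hx0)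
  refine isOpen_Ioi.ae_eq_zero_of_integral_contDiff_smul_eq_zero (hw.sub hconst) ?_
  intro ψ hψ hψc hψs
  -- `ψ - s β` has mean zero, so it is the derivative of a test function and is annihilated by `w`.
  -- Hence `∫ ψ w = s ∫ β w = s c = ∫ ψ c`.
  set s := ∫ x, ψ x
  have hIw := integrableOn_testFunction_mul hw hψ.continuous hψc hψs
  have hIβ := integrableOn_testFunction_mul hw hβ.continuous hβc hβs
  have hθs : tsupport (fun x => ψ x - s * β x) ⊆ Ioi 0 := by
    have h1 : tsupport (fun x => ψ x - s * β x) ⊆ tsupport ψ ∪ tsupport β := by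
      refine closure_minimal (fun x hx => ?_) ((isClosed_tsupport _).union (isClosed_tsupport _))
      by_contra hx'
      rw [mem_union, not_or] at hx'
      apply hx
      simp [image_eq_zero_of_notMem_tsupport hx'.1, image_eq_zero_of_notMem_tsupport hx'.2]
    exact h1.trans (union_subset hψs hβs)
  have hθc : HasCompactSupport (fun x => ψ x - s * β x) := hψc.sub (hβc.mul_left (f := fun _ => s))
  have hθ0 : ∫ x, (ψ x - s * β x) = 0 := by
    rw [integral_sub (hψ.continuous.integrable_of_hasCompactSupport hψc)
      ((hβ.continuous.integrable_of_hasCompactSupport hβc).const_mul s), integral_const_mul, hβ1]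
    simp [s]
  obtain ⟨φ, hφ, hφc, hφs, hφd⟩ := exists_primitive_testFunction
    (hψ.sub (contDiff_const.mul hβ)) hθc hθs hθ0
  have h2 := h φ hφ hφc hφs
  rw [hφd] at h2
  have h3 : ∫ x in Ioi (0 : ℝ), ψ x * w x = s * c := by
    have : ∫ x in Ioi (0 : ℝ), (ψ x - s * β x) * w x
        = (∫ x in Ioi (0 : ℝ), ψ x * w x) - s * c := by
      rw [← integral_const_mul, ← integral_sub hIw (hIβ.const_mul s)]
      congr 1; ext x; ring
    rw [this] at h2; linarith
  have h4 : ∫ x in Ioi (0 : ℝ), ψ x * c = s * c := by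
    rw [integral_mul_const, setIntegral_eq_integral_of_forall_compl_eq_zero]
    exact fun x hx => image_eq_zero_of_notMem_tsupport fun h => hx (hψs h)
  rw [← setIntegral_eq_integral_of_forall_compl_eq_zero (s := Ioi (0 : ℝ))]
  · simp only [smul_eq_mul, mul_sub]
    rw [integral_sub hIw (integrableOn_testFunction_mul hconst hψ.continuous hψc hψs), h3, h4,
      sub_self]
  · intro x hx
    rw [image_eq_zero_of_notMem_tsupport fun h => hx (hψs h), zero_smul]

/-- A locally integrable function on the half-line with a locally integrable weak derivative is
almost everywhere a primitive of that derivative. -/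
theorem exists_ae_eq_primitive {u g : ℝ → ℝ} (hu : LocallyIntegrableOn u (Ioi 0))
    (hg : LocallyIntegrableOn g (Ioi 0))
    (h : ∀ φ : ℝ → ℝ, ContDiff ℝ (⊤ : ℕ∞) φ → HasCompactSupport φ → tsupport φ ⊆ Ioi 0 →
      ∫ x in Ioi (0 : ℝ), deriv φ x * u x = -∫ x in Ioi (0 : ℝ), φ x * g x) :
    ∃ c : ℝ, ∀ᵐ x, x ∈ Ioi (0 : ℝ) → u x = c + ∫ t in (1 : ℝ)..x, g t := by
  have hcont : ContinuousOn (fun x => ∫ t in (1 : ℝ)..x, g t) (Ioi 0) := by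
    intro x (hx : 0 < x)
    have hAC := (absolutelyContinuousOnInterval_primitive hg 0 (half_pos hx)
      (by linarith : (0 : ℝ) < 2 * x)).1.continuousOn
    simp only [zero_add] at hAC
    rw [uIcc_of_le (by linarith)] at hAC
    exact (hAC.continuousAt (Icc_mem_nhds (by linarith) (by linarith))).continuousWithinAt
  have hF : LocallyIntegrableOn (fun x => ∫ t in (1 : ℝ)..x, g t) (Ioi 0) :=
    hcont.locallyIntegrableOn measurableSet_Ioi
  have hz : ∀ φ : ℝ → ℝ, ContDiff ℝ (⊤ : ℕ∞) φ → HasCompactSupport φ → tsupport φ ⊆ Ioi 0 →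
      ∫ x in Ioi (0 : ℝ), deriv φ x * (u x - ∫ t in (1 : ℝ)..x, g t) = 0 := by
    intro φ hφ hφc hφs
    have hd : HasCompactSupport (deriv φ) := hφc.deriv
    have hdc : Continuous (deriv φ) := hφ.continuous_deriv (by simp)
    have hds : tsupport (deriv φ) ⊆ Ioi 0 := (tsupport_deriv_subset).trans hφs
    simp only [mul_sub]
    rw [integral_sub (integrableOn_testFunction_mul hu hdc hd hds)
      (integrableOn_testFunction_mul hF hdc hd hds), h φ hφ hφc hφs,
      integral_deriv_mul_primitive hg hφ hφc hφs, sub_self]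
  obtain ⟨c, hc⟩ := exists_ae_eq_const_of_integral_deriv_mul_eq_zero (hu.sub hF) hz
  refine ⟨c, ?_⟩
  filter_upwards [hc] with x hx hx0
  have := hx hx0
  simp only [Pi.sub_apply] at this
  linarith

/-! ### Boundary terms at `∞` and at `0` -/

/-- A positive limit would force `Φ x / x ≥ L / (2 x)` near infinity, and the logarithmic integral
diverges there. The next lemma is the same argument at `0`. -/
theorem eq_zero_of_tendsto_of_integrableOn_div_atTop {Φ : ℝ → ℝ} {L a : ℝ} (hΦ : ∀ x, 0 ≤ Φ x)
    (hL : Tendsto Φ atTop (𝓝 L)) (hi : IntegrableOn (fun x => Φ x / x) (Ioi a)) : L = 0 := by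
  have hL0 : 0 ≤ L := ge_of_tendsto' hL hΦ
  by_contra hne
  have hpos : 0 < L := lt_of_le_of_ne hL0 (Ne.symm hne)
  obtain ⟨b, hb⟩ := eventually_atTop.1 (hL.eventually (lt_mem_nhds (half_lt_self hpos)))
  set d := max (max a b) 1
  have hd1 : (1 : ℝ) ≤ d := le_max_right _ _
  have hab : max a b ≤ d := le_max_left _ _
  have hda : a ≤ d := (le_max_left _ _).trans hab
  have hdb : b ≤ d := (le_max_right _ _).trans hab
  refine not_integrableOn_Ioi_inv (a := d) (((hi.mono_set
    (Ioi_subset_Ioi hda)).const_mul (2 / L)).mono' measurable_inv.aestronglyMeasurable ?_)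
  filter_upwards [ae_restrict_mem measurableSet_Ioi] with x (hx : d < x)
  have hx0 : 0 < x := by linarith
  have := hb x (hdb.trans hx.le)
  rw [Real.norm_eq_abs, abs_of_pos (inv_pos.2 hx0), div_mul_div_comm, le_div_iff₀ (by positivity)]
  field_simp
  linarith

theorem eq_zero_of_tendsto_of_integrableOn_div_zero {Φ : ℝ → ℝ} {L a : ℝ} (ha : 0 < a)
    (hΦ : ∀ x, 0 ≤ Φ x) (hL : Tendsto Φ (𝓝[>] 0) (𝓝 L))
    (hi : IntegrableOn (fun x => Φ x / x) (Ioc 0 a)) : L = 0 := by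
  have hL0 : 0 ≤ L := ge_of_tendsto' hL hΦ
  by_contra hne
  have hpos : 0 < L := lt_of_le_of_ne hL0 (Ne.symm hne)
  obtain ⟨b, hb, hb'⟩ :=
    mem_nhdsGT_iff_exists_Ioc_subset.1 (hL.eventually (lt_mem_nhds (half_lt_self hpos)))
  set d := min a b
  have hd : 0 < d := lt_min ha hb
  have hni : ¬ IntervalIntegrable (fun x : ℝ => x⁻¹) volume 0 d := by
    rw [intervalIntegrable_inv_iff]
    simp [hd.ne, hd.le]
  refine hni ?_
  rw [intervalIntegrable_iff_integrableOn_Ioc_of_le hd.le]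
  refine ((hi.mono_set (Ioc_subset_Ioc_right (min_le_left _ _))).const_mul (2 / L)).mono'
    measurable_inv.aestronglyMeasurable ?_
  filter_upwards [ae_restrict_mem measurableSet_Ioc] with x hx
  have hx0 : 0 < x := hx.1
  have : L / 2 < Φ x := hb' ⟨hx.1, hx.2.trans (min_le_right _ _)⟩
  rw [Real.norm_eq_abs, abs_of_pos (inv_pos.2 hx0), div_mul_div_comm, le_div_iff₀ (by positivity)]
  field_simp
  linarith

/-- `∫ u u' = 0` on the half-line, when `u u'` and `u² / r` are integrable. -/
theorem integral_mul_weakDeriv_eq_zero {u g : ℝ → ℝ} (hu : LocallyIntegrableOn u (Ioi 0))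
    (hg : LocallyIntegrableOn g (Ioi 0))
    (h : ∀ φ : ℝ → ℝ, ContDiff ℝ (⊤ : ℕ∞) φ → HasCompactSupport φ → tsupport φ ⊆ Ioi 0 →
      ∫ x in Ioi (0 : ℝ), deriv φ x * u x = -∫ x in Ioi (0 : ℝ), φ x * g x)
    (hug : IntegrableOn (fun x => u x * g x) (Ioi 0))
    (huu : IntegrableOn (fun x => u x ^ 2 / x) (Ioi 0)) :
    ∫ x in Ioi (0 : ℝ), u x * g x = 0 := by
  obtain ⟨c, hc⟩ := exists_ae_eq_primitive hu hg h
  set F : ℝ → ℝ := fun x => c + ∫ t in (1 : ℝ)..x, g t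
  have hFF : IntegrableOn (fun x => F x ^ 2 / x) (Ioi 0) := by
    refine huu.congr ?_
    filter_upwards [ae_restrict_mem measurableSet_Ioi, ae_restrict_of_ae hc] with x hx hcx
    rw [hcx hx]
  -- Fundamental theorem of calculus for `F²/2`, available because the representative `F` of `u` is
  -- absolutely continuous on compact intervals.
  have key : ∀ a b, 0 < a → 0 < b → ∫ x in a..b, u x * g x = (F b ^ 2 - F a ^ 2) / 2 := by
    intro a b ha hb
    obtain ⟨hF, hF'⟩ := absolutelyContinuousOnInterval_primitive hg c ha hb
    have h1 := hF.integral_deriv_mul_eq_sub hF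
    have h2 : ∫ x in a..b, 2 * (u x * g x) = F b * F b - F a * F a := by
      rw [← h1]
      apply intervalIntegral.integral_congr_ae
      filter_upwards [hF', hc] with x hx hcx hxm
      have hxm' := uIoc_subset_uIcc hxm
      have hx0 : x ∈ Ioi (0 : ℝ) := lt_of_lt_of_le (lt_min ha hb) hxm'.1
      rw [(hx hxm').deriv, hcx hx0]
      change 2 * (F x * g x) = g x * F x + F x * g x
      ring
    rw [intervalIntegral.integral_const_mul] at h2
    linear_combination h2 / 2
  -- Integrability of `u g` gives `F²` a limit at each end, and integrability of `F² / x` forces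
  -- both limits to be zero.
  have hA : Tendsto (fun b => F b ^ 2) atTop
      (𝓝 (F 1 ^ 2 + 2 * ∫ x in Ioi (1 : ℝ), u x * g x)) := by
    have h1 := intervalIntegral_tendsto_integral_Ioi 1
      (hug.mono_set (Ioi_subset_Ioi zero_le_one)) tendsto_id
    refine ((h1.const_mul 2).const_add (F 1 ^ 2)).congr' ?_
    filter_upwards [eventually_gt_atTop 0] with b hb
    rw [id, key 1 b one_pos hb]; ring
  have hB : Tendsto (fun b => F b ^ 2) (𝓝[>] 0)
      (𝓝 (F 1 ^ 2 - 2 * ∫ x in (0 : ℝ)..1, u x * g x)) := by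
    have hint : IntegrableOn (fun x => u x * g x) (uIcc 0 1) := by
      rw [uIcc_of_le zero_le_one, integrableOn_Icc_iff_integrableOn_Ioc]
      exact hug.mono_set fun x hx => hx.1
    have h1 := (intervalIntegral.continuousOn_primitive_interval_left hint) 0 left_mem_uIcc
    rw [uIcc_of_le zero_le_one] at h1
    have h2 := h1.tendsto.mono_left
      (nhdsWithin_le_of_mem (Icc_mem_nhdsGT (zero_lt_one : (0 : ℝ) < 1)))
    refine ((h2.const_mul 2).const_sub (F 1 ^ 2)).congr' ?_
    filter_upwards [self_mem_nhdsWithin] with b hb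
    rw [key b 1 hb one_pos]; ring
  have hA0 := eq_zero_of_tendsto_of_integrableOn_div_atTop (fun x => sq_nonneg _) hA hFF
  have hB0 := eq_zero_of_tendsto_of_integrableOn_div_zero one_pos (fun x => sq_nonneg _) hB
    (hFF.mono_set Ioc_subset_Ioi_self)
  have hsplit : ∫ x in Ioi (0 : ℝ), u x * g x
      = (∫ x in (0 : ℝ)..1, u x * g x) + ∫ x in Ioi (1 : ℝ), u x * g x := by
    rw [intervalIntegral.integral_of_le zero_le_one, ← setIntegral_union _ measurableSet_Ioi
      (hug.mono_set Ioc_subset_Ioi_self) (hug.mono_set (Ioi_subset_Ioi zero_le_one)),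
      Ioc_union_Ioi_eq_Ioi zero_le_one]
    exact Set.disjoint_left.2 fun x hx hx' => absurd hx.2 (not_le.2 hx')
  rw [hsplit]
  linarith

/-! ### Completing the square -/

theorem integrable_mul_conj {α : Type*} [MeasurableSpace α] {μ : Measure α} {u v : α → ℂ}
    (hu : MemLp u 2 μ) (hv : MemLp v 2 μ) : Integrable (fun x => u x * conj (v x)) μ :=
  hu.integrable_mul hv.star

/-- The identity is pointwise. It is stated over an arbitrary measure so that it serves both the
plane and `r dr`. -/
theorem integral_completed_square {α : Type*} [MeasurableSpace α] {μ : Measure α}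
    {u v P Q : α → ℂ} (hu : MemLp u 2 μ) (hv : MemLp v 2 μ) (hP : MemLp P 2 μ)
    (hQ : MemLp Q 2 μ) (ν : ℝ) :
    ∫ x, (‖u x + ν * P x‖ ^ 2 + ‖v x - ν * Q x‖ ^ 2) ∂μ
      = ∫ x, (‖u x‖ ^ 2 + ‖v x‖ ^ 2) ∂μ + ν ^ 2 * ∫ x, (‖P x‖ ^ 2 + ‖Q x‖ ^ 2) ∂μ
        + 2 * ν * (∫ x, (u x * conj (P x) - v x * conj (Q x)) ∂μ).re := by
  have i1 : Integrable (fun x => ‖u x‖ ^ 2 + ‖v x‖ ^ 2) μ :=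
    (hu.integrable_norm_pow (by norm_num)).add (hv.integrable_norm_pow (by norm_num))
  have i2 : Integrable (fun x => ‖P x‖ ^ 2 + ‖Q x‖ ^ 2) μ :=
    (hP.integrable_norm_pow (by norm_num)).add (hQ.integrable_norm_pow (by norm_num))
  have i3 : Integrable (fun x => u x * conj (P x) - v x * conj (Q x)) μ :=
    (integrable_mul_conj hu hP).sub (integrable_mul_conj hv hQ)
  have i4 : Integrable (fun x => (u x * conj (P x) - v x * conj (Q x)).re) μ := i3.re
  have h3 : (∫ x, (u x * conj (P x) - v x * conj (Q x)) ∂μ).re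
      = ∫ x, (u x * conj (P x) - v x * conj (Q x)).re ∂μ := (integral_re i3).symm
  rw [h3, ← integral_const_mul, ← integral_const_mul, ← integral_add i1 (i2.const_mul _),
    ← integral_add (by exact i1.add (i2.const_mul _)) (i4.const_mul _)]
  refine integral_congr_ae (Eventually.of_forall fun x => ?_)
  simp only [← Complex.normSq_eq_norm_sq, Complex.normSq_apply, Complex.add_re, Complex.add_im,
    Complex.sub_re, Complex.sub_im, Complex.mul_re, Complex.mul_im, Complex.ofReal_re,
    Complex.ofReal_im, Complex.conj_re, Complex.conj_im]
  ring

/-! ### The measure `r dr` -/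

theorem integrable_radialMeasure_iff {E : Type*} [NormedAddCommGroup E] [NormedSpace ℝ E]
    {h : ℝ → E} : Integrable h radialMeasure ↔ IntegrableOn (fun r => r • h r) (Ioi 0) := by
  rw [radialMeasure, integrable_withDensity_iff_integrable_smul' ENNReal.measurable_ofReal
    (by simp)]
  refine integrable_congr ?_
  filter_upwards [ae_restrict_mem measurableSet_Ioi] with r hr
  rw [ENNReal.toReal_ofReal (le_of_lt hr)]

theorem integral_radialMeasure {E : Type*} [NormedAddCommGroup E] [NormedSpace ℝ E]
    (h : ℝ → E) : ∫ r, h r ∂radialMeasure = ∫ r in Ioi (0 : ℝ), r • h r := by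
  rw [radialMeasure, integral_withDensity_eq_integral_toReal_smul ENNReal.measurable_ofReal
    (by simp)]
  refine integral_congr_ae ?_
  filter_upwards [ae_restrict_mem measurableSet_Ioi] with r hr
  rw [ENNReal.toReal_ofReal (le_of_lt hr)]

instance : IsFiniteMeasureOnCompacts radialMeasure := by
  refine ⟨fun K hK => ?_⟩
  rw [radialMeasure, withDensity_apply _ hK.measurableSet]
  have h : IntegrableOn (fun r : ℝ => r) K (volume.restrict (Ioi 0)) :=
    continuous_id.continuousOn.integrableOn_compact hK
  exact h.lintegral_lt_top

theorem ae_radialMeasure_iff {p : ℝ → Prop} :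
    (∀ᵐ r ∂radialMeasure, p r) ↔ ∀ᵐ r, r ∈ Ioi (0 : ℝ) → p r := by
  rw [radialMeasure, ae_withDensity_iff ENNReal.measurable_ofReal,
    ae_restrict_iff' measurableSet_Ioi]
  refine eventually_congr (Eventually.of_forall fun r => forall_congr' fun hr => ?_)
  have : ENNReal.ofReal r ≠ 0 := by simpa using hr
  simp [this]

/-- A compact set has finite measure, so `L²` lies in `L¹` there. On a compact subset of `(0, ∞)`
the weight can then be divided out, as `1/r` is continuous. -/
theorem locallyIntegrableOn_of_memLp_radialMeasure {f : ℝ → ℂ} (hf : MemLp f 2 radialMeasure) :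
    LocallyIntegrableOn f (Ioi 0) := by
  rw [locallyIntegrableOn_iff isOpen_Ioi.isLocallyClosed]
  intro K hK hKc
  have : Fact (radialMeasure K < ⊤) := ⟨hKc.measure_lt_top⟩
  have h1 : IntegrableOn f K radialMeasure :=
    (hf.restrict K).integrable (by norm_num)
  have h2 : Integrable (K.indicator f) radialMeasure :=
    (integrable_indicator_iff hKc.measurableSet).2 h1
  have h3 := (integrable_radialMeasure_iff.1 h2).mono_set hK
  have h4 : IntegrableOn (fun r => r⁻¹ • r • K.indicator f r) K :=
    h3.continuousOn_smul (continuousOn_inv₀.mono fun r hr => ne_of_gt (hK hr)) hKc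
  refine h4.congr_fun (fun r hr => ?_) hKc.measurableSet
  have : r ≠ 0 := ne_of_gt (hK hr)
  simp only [indicator_of_mem hr]
  rw [smul_smul, inv_mul_cancel₀ this, one_smul]

/-! ### Completing the square in the radial energy -/

theorem HRad.memLp_raise {l : ℤ} (f : HRad l) : MemLp f.raise 2 radialMeasure :=
  f.memLp_dr.add f.memLp_div

theorem HRad.memLp_lower {l : ℤ} (f : HRad l) : MemLp f.lower 2 radialMeasure :=
  f.memLp_dr.sub f.memLp_div

/-- The weight `r` cancels `1/r` and leaves `l ∫ Re(f' f̄) dr`, the integral of `(l/2) (|f|²)'`. The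
boundary terms vanish because `|f|² / r` is integrable. -/
theorem HRad.integral_cross {l : ℤ} (f : HRad l) :
    ∫ r, (f.dr r * conj ((l : ℂ) / (r : ℂ) * f r)).re ∂radialMeasure = 0 := by
  have hint := integrable_mul_conj f.memLp_dr f.memLp_div
  have hfl := locallyIntegrableOn_of_memLp_radialMeasure f.memLp_toFun
  have hgl := locallyIntegrableOn_of_memLp_radialMeasure f.memLp_dr
  -- For `l = 0` membership in `H_l` says nothing about `|f|² / r`, but the integrand is then
  -- identically zero.
  rcases eq_or_ne l 0 with rfl | hl
  · simp
  have hl' : (l : ℝ) ≠ 0 := by exact_mod_cast hl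
  -- `T` stands for the real or the imaginary part, which reduces the claim to real functions.
  have key : ∀ T : ℂ →L[ℝ] ℝ, (∀ z, |T z| ≤ ‖z‖) →
      IntegrableOn (fun r => T (f r) * T (f.dr r)) (Ioi 0) ∧
      ∫ r in Ioi (0 : ℝ), T (f r) * T (f.dr r) = 0 := by
    intro T hT
    have hTf : LocallyIntegrableOn (fun r => T (f r)) (Ioi 0) := fun x hx =>
      (hfl x hx).imp fun s hs => ⟨hs.1, T.integrable_comp hs.2⟩
    have hTg : LocallyIntegrableOn (fun r => T (f.dr r)) (Ioi 0) := fun x hx =>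
      (hgl x hx).imp fun s hs => ⟨hs.1, T.integrable_comp hs.2⟩
    have hTT : IntegrableOn (fun r => T (f r) * T (f.dr r)) (Ioi 0) := by
      have h1 := (integrable_radialMeasure_iff.1 hint).norm.const_mul |(l : ℝ)|⁻¹
      refine h1.mono' ((hTf.aestronglyMeasurable).mul (hTg.aestronglyMeasurable)) ?_
      filter_upwards [ae_restrict_mem measurableSet_Ioi] with r (hr : 0 < r)
      have e : ‖r • (f.dr r * conj ((l : ℂ) / (r : ℂ) * f r))‖ = |(l : ℝ)| * (‖f r‖ * ‖f.dr r‖) := by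
        simp only [norm_smul, norm_mul, RCLike.norm_conj, norm_div, Complex.norm_real,
          Complex.norm_intCast, Real.norm_eq_abs, abs_of_pos hr]
        field_simp
      rw [e, inv_mul_cancel_left₀ (abs_ne_zero.2 hl'), Real.norm_eq_abs, abs_mul]
      exact mul_le_mul (hT _) (hT _) (abs_nonneg _) (norm_nonneg _)
    have hT2 : IntegrableOn (fun r => T (f r) ^ 2 / r) (Ioi 0) := by
      have h1 := (integrable_radialMeasure_iff.1
        (f.memLp_div.integrable_norm_pow (by norm_num))).const_mul ((l : ℝ) ^ 2)⁻¹
      refine h1.mono' ((hTf.aestronglyMeasurable.pow 2).mul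
        measurable_inv.aestronglyMeasurable) ?_
      filter_upwards [ae_restrict_mem measurableSet_Ioi] with r (hr : 0 < r)
      have e : r • ‖(l : ℂ) / (r : ℂ) * f r‖ ^ 2 = (l : ℝ) ^ 2 * (‖f r‖ ^ 2 / r) := by
        simp only [norm_mul, norm_div, Complex.norm_real, Complex.norm_intCast,
          Real.norm_eq_abs, abs_of_pos hr, mul_pow, div_pow, sq_abs, smul_eq_mul]
        field_simp
      rw [e, inv_mul_cancel_left₀ (pow_ne_zero 2 hl'), Real.norm_eq_abs, abs_of_nonneg
        (by positivity)]
      refine div_le_div_of_nonneg_right ?_ hr.le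
      rw [← sq_abs]
      exact pow_le_pow_left₀ (abs_nonneg _) (hT _) 2
    refine ⟨hTT, integral_mul_weakDeriv_eq_zero hTf hTg (fun φ hφ hc hs => ?_) hTT hT2⟩
    have h1 := f.isWeakDeriv φ hφ hc hs
    have j1 : IntegrableOn (fun r => deriv φ r • f r) (Ioi 0) :=
      integrableOn_testFunction_smul hfl (hφ.continuous_deriv (by simp)) hc.deriv
        (tsupport_deriv_subset.trans hs)
    have j2 : IntegrableOn (fun r => φ r • f.dr r) (Ioi 0) :=
      integrableOn_testFunction_smul hgl hφ.continuous hc hs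
    have h2 := congrArg T h1
    rw [map_neg, ← T.integral_comp_comm j1, ← T.integral_comp_comm j2] at h2
    simpa only [map_smul, smul_eq_mul] using h2
  obtain ⟨a1, a2⟩ := key Complex.reCLM Complex.abs_re_le_norm
  obtain ⟨b1, b2⟩ := key Complex.imCLM Complex.abs_im_le_norm
  rw [integral_radialMeasure]
  calc ∫ r in Ioi (0 : ℝ), r • (f.dr r * conj ((l : ℂ) / (r : ℂ) * f r)).re
      = ∫ r in Ioi (0 : ℝ), (l : ℝ) * (Complex.reCLM (f r) * Complex.reCLM (f.dr r)
          + Complex.imCLM (f r) * Complex.imCLM (f.dr r)) := by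
        refine setIntegral_congr_fun measurableSet_Ioi fun r (hr : 0 < r) => ?_
        have e : (l : ℂ) / (r : ℂ) = ((l / r : ℝ) : ℂ) := by push_cast; rfl
        simp only [e, map_mul, Complex.conj_ofReal, Complex.mul_re, Complex.mul_im,
          Complex.ofReal_re, Complex.ofReal_im, Complex.conj_re, Complex.conj_im,
          Complex.reCLM_apply, Complex.imCLM_apply, smul_eq_mul]
        field_simp
        ring
    _ = 0 := by rw [integral_const_mul, integral_add a1 b1, a2, b2]; simp

theorem HRad.norm_sq_div_mul {l : ℤ} (f : HRad l) (r : ℝ) :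
    ‖(l : ℂ) / (r : ℂ) * f r‖ ^ 2 = (l : ℝ) ^ 2 / r ^ 2 * ‖f r‖ ^ 2 := by
  simp [mul_pow, div_pow, sq_abs]

theorem HRad.integrable_kinetic {l : ℤ} (f : HRad l) :
    Integrable (fun r => ‖f.dr r‖ ^ 2 + (l : ℝ) ^ 2 / r ^ 2 * ‖f r‖ ^ 2) radialMeasure := by
  simp only [← f.norm_sq_div_mul]
  exact (f.memLp_dr.integrable_norm_pow (by norm_num)).add
    (f.memLp_div.integrable_norm_pow (by norm_num))

/-- Expanding the square leaves only the cross term, whose integral vanishes. The signs `s = 1` and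
`s = -1` give the raising and the lowering operator. -/
theorem HRad.integral_norm_sq_dr_add {l : ℤ} (f : HRad l) {s : ℝ} (hs : s ^ 2 = 1) :
    ∫ r, ‖f.dr r + s * ((l : ℂ) / (r : ℂ) * f r)‖ ^ 2 ∂radialMeasure
      = ∫ r, (‖f.dr r‖ ^ 2 + (l : ℝ) ^ 2 / r ^ 2 * ‖f r‖ ^ 2) ∂radialMeasure := by
  have i3 : Integrable (fun r => (f.dr r * conj ((l : ℂ) / (r : ℂ) * f r)).re) radialMeasure :=
    (integrable_mul_conj f.memLp_dr f.memLp_div).re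
  have h : ∀ r, ‖f.dr r + s * ((l : ℂ) / (r : ℂ) * f r)‖ ^ 2
      = (‖f.dr r‖ ^ 2 + (l : ℝ) ^ 2 / r ^ 2 * ‖f r‖ ^ 2)
        + 2 * s * (f.dr r * conj ((l : ℂ) / (r : ℂ) * f r)).re := by
    intro r
    rw [← f.norm_sq_div_mul]
    generalize (l : ℂ) / (r : ℂ) * f r = w
    simp only [← Complex.normSq_eq_norm_sq, Complex.normSq_apply, Complex.add_re, Complex.add_im,
      Complex.mul_re, Complex.mul_im, Complex.ofReal_re, Complex.ofReal_im, Complex.conj_re,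
      Complex.conj_im]
    linear_combination (w.re ^ 2 + w.im ^ 2) * hs
  simp only [h]
  rw [integral_add f.integrable_kinetic (i3.const_mul _), integral_const_mul]
  have := f.integral_cross
  simp only [this, mul_zero, add_zero]

theorem HRad.integral_norm_sq_raise {l : ℤ} (f : HRad l) :
    ∫ r, ‖f.raise r‖ ^ 2 ∂radialMeasure
      = ∫ r, (‖f.dr r‖ ^ 2 + (l : ℝ) ^ 2 / r ^ 2 * ‖f r‖ ^ 2) ∂radialMeasure := by
  rw [← f.integral_norm_sq_dr_add (one_pow 2)]
  simp [HRad.raise]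

theorem HRad.integral_norm_sq_lower {l : ℤ} (f : HRad l) :
    ∫ r, ‖f.lower r‖ ^ 2 ∂radialMeasure
      = ∫ r, (‖f.dr r‖ ^ 2 + (l : ℝ) ^ 2 / r ^ 2 * ‖f r‖ ^ 2) ∂radialMeasure := by
  rw [← f.integral_norm_sq_dr_add (s := -1) (by norm_num)]
  simp [HRad.lower, sub_eq_add_neg]

/-- The squared `L²` norm of the defect of `(p, q)` in the first-order system
`q' + ((m + 1) / r) q = -ν p`, `p' - (m / r) p = ν q`. -/
noncomputable def defectRad (ν : ℝ) {m : ℤ} (p : HRad m) (q : HRad (m + 1)) : ℝ :=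
  ∫ r, (‖q.raise r + ν * p r‖ ^ 2 + ‖p.lower r - ν * q r‖ ^ 2) ∂radialMeasure

/-- The kinetic energy is first rewritten through `q.raise` and `p.lower`, which are also the
expressions in the spin-orbit term. The square is then completed pointwise. -/
theorem energyLinRad_eq (ν : ℝ) {m : ℤ} (p : HRad m) (q : HRad (m + 1)) :
    energyLinRad ν p q = 1 / 4 * defectRad ν p q - ν ^ 2 / 4 * massRad p q := by
  have h1 : kineticRad p q = 1 / 4 * ∫ r, (‖q.raise r‖ ^ 2 + ‖p.lower r‖ ^ 2) ∂radialMeasure := by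
    rw [integral_add (q.memLp_raise.integrable_norm_pow (by norm_num))
      (p.memLp_lower.integrable_norm_pow (by norm_num)), q.integral_norm_sq_raise,
      p.integral_norm_sq_lower, ← integral_add q.integrable_kinetic p.integrable_kinetic,
      kineticRad]
    congr 2
    ext r
    push_cast
    ring
  rw [defectRad, integral_completed_square q.memLp_raise p.memLp_lower p.memLp_toFun
    q.memLp_toFun, energyLinRad, h1, spinOrbitRad, massRad]
  ring

/-! ### Amplitude scaling and the criterion for strict inequality, radial case -/

theorem le_infEnergyLinRad (m : ℤ) (ν ρ : ℝ) :
    ((-(ν ^ 2 / 4 * ρ) : ℝ) : EReal) ≤ infEnergyLinRad m ν ρ := by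
  refine le_sInf ?_
  rintro e ⟨p, q, hM, rfl⟩
  rw [EReal.coe_le_coe_iff, energyLinRad_eq, hM]
  have : 0 ≤ defectRad ν p q := integral_nonneg fun r => by positivity
  linarith

/-- The real multiple `t f`. -/
def HRad.smul {l : ℤ} (t : ℝ) (f : HRad l) : HRad l where
  toFun r := t * f r
  dr r := t * f.dr r
  memLp_toFun := f.memLp_toFun.const_mul _
  memLp_dr := f.memLp_dr.const_mul _
  memLp_div := by simpa only [mul_left_comm] using f.memLp_div.const_mul (t : ℂ)
  isWeakDeriv φ hφ hc hs := by
    simp only [Complex.real_smul, mul_left_comm _ (t : ℂ)]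
    rw [integral_const_mul, integral_const_mul, ← mul_neg]
    have := f.isWeakDeriv φ hφ hc hs
    simp only [Complex.real_smul] at this
    rw [this]

theorem massRad_smul {m : ℤ} (p : HRad m) (q : HRad (m + 1)) (t : ℝ) :
    massRad (p.smul t) (q.smul t) = t ^ 2 * massRad p q := by
  simp only [massRad, HRad.smul, norm_mul, Complex.norm_real, Real.norm_eq_abs, mul_pow, sq_abs]
  rw [← integral_const_mul]
  congr 1; ext r; ring

theorem defectRad_smul (ν : ℝ) {m : ℤ} (p : HRad m) (q : HRad (m + 1)) (t : ℝ) :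
    defectRad ν (p.smul t) (q.smul t) = t ^ 2 * defectRad ν p q := by
  have h1 : ∀ r, (q.smul t).raise r + ν * (p.smul t) r = t * (q.raise r + ν * p r) := fun r => by
    simp only [HRad.raise, HRad.smul]; ring
  have h2 : ∀ r, (p.smul t).lower r - ν * (q.smul t) r = t * (p.lower r - ν * q r) := fun r => by
    simp only [HRad.lower, HRad.smul]; ring
  simp only [defectRad, h1, h2, norm_mul, Complex.norm_real, Real.norm_eq_abs, mul_pow, sq_abs]
  rw [← integral_const_mul]
  congr 1; ext r; ring

theorem quarticRad_smul (lp lm l0 : ℝ) {m : ℤ} (p : HRad m) (q : HRad (m + 1)) (t : ℝ) :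
    quarticRad lp lm l0 (p.smul t) (q.smul t) = t ^ 4 * quarticRad lp lm l0 p q := by
  have h4 : |t| ^ 4 = t ^ 4 := by rw [← abs_pow]; exact abs_of_nonneg (by positivity)
  simp only [quarticRad, HRad.smul, norm_mul, Complex.norm_real, Real.norm_eq_abs, mul_pow, sq_abs,
    h4]
  rw [mul_left_comm]
  congr 1
  rw [← integral_const_mul]
  congr 1; ext r; ring

theorem scaled_energy_neg {M D N ρ : ℝ} (hM : 0 < M) (hρ : 0 < ρ) (h : D * M < 4 * N * ρ) :
    1 / 4 * (ρ / M * D) - (ρ / M) ^ 2 * N < 0 := by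
  have h1 : 1 / 4 * (ρ / M * D) - (ρ / M) ^ 2 * N = ρ / (4 * M ^ 2) * (D * M - 4 * N * ρ) := by
    field_simp
  rw [h1]
  exact mul_neg_of_pos_of_neg (by positivity) (by linarith)

/-- Rescaling the amplitude to mass `ρ` puts the energy below `-ν²ρ/4`. That is a lower bound for
the linear infimum, and whether the infimum equals it is irrelevant. -/
theorem infEnergyRad_lt_of_defectRad_mul_massRad_lt {ν lp lm l0 ρ : ℝ} (hρ : 0 < ρ) {m : ℤ}
    (p : HRad m) (q : HRad (m + 1)) (hM : 0 < massRad p q)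
    (h : defectRad ν p q * massRad p q < 4 * quarticRad lp lm l0 p q * ρ) :
    infEnergyRad m ν lp lm l0 ρ < infEnergyLinRad m ν ρ := by
  refine lt_of_lt_of_le ?_ (le_infEnergyLinRad m ν ρ)
  set t := Real.sqrt (ρ / massRad p q)
  have ht : t ^ 2 = ρ / massRad p q := Real.sq_sqrt (by positivity)
  have ht4 : t ^ 4 = (ρ / massRad p q) ^ 2 := by rw [← ht]; ring
  have hmass : massRad (p.smul t) (q.smul t) = ρ := by
    rw [massRad_smul, ht, div_mul_cancel₀ _ hM.ne']
  refine lt_of_le_of_lt (sInf_le ⟨p.smul t, q.smul t, hmass, rfl⟩) ?_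
  have e : energyRad ν lp lm l0 (p.smul t) (q.smul t)
      = energyLinRad ν (p.smul t) (q.smul t) - quarticRad lp lm l0 (p.smul t) (q.smul t) := rfl
  rw [EReal.coe_lt_coe_iff, e, energyLinRad_eq, hmass, defectRad_smul, quarticRad_smul, ht, ht4]
  have := scaled_energy_neg hM hρ h
  linarith

/-! ### Solutions of the radial first-order system -/

/-- `(p, q)` solves `p' = (m / r) p + ν q`, `q' = -((m + 1) / r) q - ν p` on `(0, ∞)`. -/
structure IsRadialSolution (m : ℤ) (ν : ℝ) (p q : ℝ → ℝ) : Prop where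
  hasDerivAt_fst : ∀ r, 0 < r → HasDerivAt p (m / r * p r + ν * q r) r
  hasDerivAt_snd : ∀ r, 0 < r → HasDerivAt q (-((m + 1) / r * q r) - ν * p r) r

namespace IsRadialSolution

variable {m : ℤ} {ν : ℝ} {p q : ℝ → ℝ}

/-- The coupling terms `2ν p q` and `-2ν p q` cancel. What remains is proportional to `p² - q²`,
which also appears in the derivative of `p q`, so a combination of the two can remove it. -/
theorem hasDerivAt_density (h : IsRadialSolution m ν p q) {r : ℝ} (hr : 0 < r) :
    HasDerivAt (fun r => r * (p r ^ 2 + q r ^ 2)) ((2 * m + 1) * (p r ^ 2 - q r ^ 2)) r := by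
  have := (hasDerivAt_id r).mul (((h.hasDerivAt_fst r hr).pow 2).add ((h.hasDerivAt_snd r hr).pow 2))
  refine this.congr_deriv ?_
  simp only [id, Pi.add_apply, Pi.pow_apply]
  field_simp
  ring

theorem hasDerivAt_mul (h : IsRadialSolution m ν p q) {r : ℝ} (hr : 0 < r) :
    HasDerivAt (fun r => p r * q r) (-(p r * q r / r) - ν * (p r ^ 2 - q r ^ 2)) r := by
  refine ((h.hasDerivAt_fst r hr).mul (h.hasDerivAt_snd r hr)).congr_deriv ?_
  field_simp
  ring

/-- A Grönwall argument: the density `G = r (p² + q²)` satisfies `|G'| ≤ n G / r` with `n = |2m +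
1|`, so `rⁿ G` is nondecreasing and cannot return to zero. -/
theorem pos_of_le (h : IsRadialSolution m ν p q) {r₁ r : ℝ} (hr₁ : 0 < r₁)
    (hpos : 0 < p r₁ ^ 2 + q r₁ ^ 2) (hr : r₁ ≤ r) : 0 < p r ^ 2 + q r ^ 2 := by
  set n := (2 * m + 1).natAbs
  have hn : |(2 * m + 1 : ℝ)| = n := by
    have : ((2 * m + 1).natAbs : ℝ) = |((2 * m + 1 : ℤ) : ℝ)| := by
      rw [← Int.cast_abs, Int.abs_eq_natAbs]; simp
    rw [this]; push_cast; rfl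
  have hd : ∀ x, 0 < x → HasDerivAt (fun r => r ^ n * (r * (p r ^ 2 + q r ^ 2)))
      (x ^ n * (n * (p x ^ 2 + q x ^ 2) + (2 * m + 1) * (p x ^ 2 - q x ^ 2))) x := by
    intro x hx
    refine ((hasDerivAt_pow n x).mul (h.hasDerivAt_density hx)).congr_deriv ?_
    rcases Nat.eq_zero_or_pos n with h0 | h0
    · simp [h0]
    · obtain ⟨k, hk⟩ := Nat.exists_eq_succ_of_ne_zero h0.ne'
      rw [hk]
      simp only [Nat.succ_eq_add_one, Nat.add_sub_cancel]
      ring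
  have hmono : MonotoneOn (fun r => r ^ n * (r * (p r ^ 2 + q r ^ 2))) (Ici r₁) := by
    refine monotoneOn_of_deriv_nonneg (convex_Ici _)
      (fun x hx => (hd x (hr₁.trans_le hx)).continuousAt.continuousWithinAt)
      (fun x hx => (hd x (hr₁.trans_le (interior_subset hx))).differentiableAt.differentiableWithinAt)
      fun x hx => ?_
    have hx0 : 0 < x := hr₁.trans_le (interior_subset hx)
    rw [(hd x hx0).deriv, ← hn]
    refine mul_nonneg (by positivity) ?_
    have h1 := neg_abs_le (2 * m + 1 : ℝ)
    have h2 := le_abs_self (2 * m + 1 : ℝ)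
    nlinarith [sq_nonneg (p x), sq_nonneg (q x)]
  have h1 := hmono self_mem_Ici (mem_Ici.2 hr) hr
  have hr0 : 0 < r := hr₁.trans_le hr
  have h2 : 0 < r ^ n * (r * (p r ^ 2 + q r ^ 2)) := lt_of_lt_of_le (by positivity) h1
  exact pos_of_mul_pos_right (pos_of_mul_pos_right h2 (by positivity)) hr0.le

/-- A nontrivial solution has density `r (p² + q²)` bounded away from `0` and `∞` near `∞`. -/
theorem exists_bounds_atTop (h : IsRadialSolution m ν p q) (hν : 0 < ν) {r₁ : ℝ} (hr₁ : 0 < r₁)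
    (hpos : 0 < p r₁ ^ 2 + q r₁ ^ 2) :
    ∃ r₀ c C, 0 < r₀ ∧ 0 < c ∧
      ∀ r, r₀ ≤ r → c ≤ r * (p r ^ 2 + q r ^ 2) ∧ r * (p r ^ 2 + q r ^ 2) ≤ C := by
  -- This `k` makes the `p² - q²` terms cancel in the derivative of `H = G + k p q`, leaving `H' =
  -- -k p q / r`, which is of order `H / r²`.
  set k : ℝ := (2 * m + 1) / ν
  -- Beyond `|k|` the correction `k p q` is at most `G / 2` in absolute value, so `H` and `G` are
  -- comparable.
  set r₀ := max r₁ |k|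
  have hr₀ : 0 < r₀ := lt_max_of_lt_left hr₁
  set G : ℝ → ℝ := fun r => r * (p r ^ 2 + q r ^ 2)
  set H : ℝ → ℝ := fun r => G r + k * (p r * q r)
  have hpq : ∀ r, |k * (p r * q r)| ≤ |k| * (p r ^ 2 + q r ^ 2) / 2 := by
    intro r
    have : |p r * q r| ≤ (p r ^ 2 + q r ^ 2) / 2 := by
      rw [abs_le]; constructor <;> nlinarith [sq_nonneg (p r + q r), sq_nonneg (p r - q r)]
    rw [abs_mul]
    have := mul_le_mul_of_nonneg_left this (abs_nonneg k)
    linarith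
  have hG : ∀ r, r₀ ≤ r → 0 < G r ∧ G r / 2 ≤ H r ∧ H r ≤ 3 / 2 * G r := by
    intro r hr
    have hr1 : r₁ ≤ r := (le_max_left _ _).trans hr
    have hrk : |k| ≤ r := (le_max_right _ _).trans hr
    have hS := h.pos_of_le hr₁ hpos hr1
    have h1 := abs_le.1 ((hpq r).trans
      (div_le_div_of_nonneg_right (mul_le_mul_of_nonneg_right hrk hS.le) zero_le_two))
    refine ⟨mul_pos (hr₁.trans_le hr1) hS, ?_, ?_⟩ <;> simp only [H, G] <;> linarith [h1.1, h1.2]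
  have hH' : ∀ r, 0 < r → HasDerivAt H (-(k * (p r * q r) / r)) r := by
    intro r hr
    refine ((h.hasDerivAt_density hr).add ((h.hasDerivAt_mul hr).const_mul k)).congr_deriv ?_
    simp only [k]
    field_simp
    ring
  have hbound : ∀ r, r₀ ≤ r → |-(k * (p r * q r) / r)| ≤ |k| * H r / r ^ 2 := by
    intro r hr
    have hr0 : 0 < r := hr₀.trans_le hr
    rw [abs_neg, abs_div, abs_of_pos hr0, div_le_div_iff₀ hr0 (by positivity)]
    have h1 := hpq r
    have h2 := mul_le_mul_of_nonneg_left (hG r hr).2.1 (abs_nonneg k)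
    simp only [G] at h2
    have h3 := mul_le_mul_of_nonneg_right h1 (sq_nonneg r)
    have h4 := mul_le_mul_of_nonneg_right h2 hr0.le
    linarith
  -- Integrating factor for `|H'| ≤ |k| H / r²`: the product with `exp (s / r)` increases for `s =
  -- -|k|` and decreases for `s = |k|`. As `1/r²` is integrable at infinity, this bounds `H` from
  -- both sides.
  have hE : ∀ (s r : ℝ), 0 < r → HasDerivAt (fun r => H r * Real.exp (s / r))
      ((-(k * (p r * q r) / r) - s * H r / r ^ 2) * Real.exp (s / r)) r := by
    intro s r hr
    have h1 : HasDerivAt (fun r => s / r) (-(s / r ^ 2)) r := by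
      simpa [div_eq_mul_inv] using (hasDerivAt_inv hr.ne').const_mul s
    refine ((hH' r hr).mul h1.exp).congr_deriv ?_
    ring
  have hmono : MonotoneOn (fun r => H r * Real.exp (-|k| / r)) (Ici r₀) := by
    refine monotoneOn_of_deriv_nonneg (convex_Ici _)
      (fun x hx => (hE _ x (hr₀.trans_le hx)).continuousAt.continuousWithinAt)
      (fun x hx =>
        (hE _ x (hr₀.trans_le (interior_subset hx))).differentiableAt.differentiableWithinAt)
      fun x hx => ?_
    have hx0 := interior_subset hx
    rw [(hE _ x (hr₀.trans_le hx0)).deriv]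
    refine mul_nonneg ?_ (Real.exp_pos _).le
    have := (abs_le.1 (hbound x hx0)).1
    rw [neg_mul, neg_div]; linarith
  have hanti : AntitoneOn (fun r => H r * Real.exp (|k| / r)) (Ici r₀) := by
    refine antitoneOn_of_deriv_nonpos (convex_Ici _)
      (fun x hx => (hE _ x (hr₀.trans_le hx)).continuousAt.continuousWithinAt)
      (fun x hx =>
        (hE _ x (hr₀.trans_le (interior_subset hx))).differentiableAt.differentiableWithinAt)
      fun x hx => ?_
    have hx0 := interior_subset hx
    rw [(hE _ x (hr₀.trans_le hx0)).deriv]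
    refine mul_nonpos_of_nonpos_of_nonneg ?_ (Real.exp_pos _).le
    have := (abs_le.1 (hbound x hx0)).2
    linarith
  have hH0 : 0 < H r₀ := by have := hG r₀ le_rfl; linarith [this.1, this.2.1]
  refine ⟨r₀, 2 / 3 * (H r₀ * Real.exp (-|k| / r₀)), 2 * (H r₀ * Real.exp (|k| / r₀)), hr₀,
    by positivity, fun r hr => ?_⟩
  have hr0 : 0 < r := hr₀.trans_le hr
  obtain ⟨g1, g2, g3⟩ := hG r hr
  have hHr : 0 < H r := by linarith
  have e1 : Real.exp (-|k| / r) ≤ 1 := Real.exp_le_one_iff.2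
    (div_nonpos_of_nonpos_of_nonneg (neg_nonpos.2 (abs_nonneg k)) hr0.le)
  have e2 : 1 ≤ Real.exp (|k| / r) := Real.one_le_exp (by positivity)
  have m1 : H r₀ * Real.exp (-|k| / r₀) ≤ H r * Real.exp (-|k| / r) := hmono self_mem_Ici hr hr
  have m2 : H r * Real.exp (|k| / r) ≤ H r₀ * Real.exp (|k| / r₀) := hanti self_mem_Ici hr hr
  have n1 := mul_le_mul_of_nonneg_left e1 hHr.le
  have n2 := mul_le_mul_of_nonneg_left e2 hHr.le
  change _ ≤ G r ∧ G r ≤ _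
  constructor <;> linarith

end IsRadialSolution

/-! ### Smooth compactly supported elements of `H_l` -/

theorem integral_Ioi_deriv_smul_ofReal {p φ : ℝ → ℝ} (hp : ContDiff ℝ 1 p)
    (hφ : ContDiff ℝ (⊤ : ℕ∞) φ) (hc : HasCompactSupport φ)
    (hs : tsupport φ ⊆ Ioi 0) :
    ∫ r in Ioi (0 : ℝ), deriv φ r • (p r : ℂ) = -∫ r in Ioi (0 : ℝ), φ r • ((deriv p r : ℝ) : ℂ) := by
  have hdφ : Continuous (deriv φ) := hφ.continuous_deriv (by simp)
  have hdp : Continuous (deriv p) := hp.continuous_deriv le_rfl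
  simp only [Complex.real_smul, ← Complex.ofReal_mul]
  rw [integral_complex_ofReal, integral_complex_ofReal, ← Complex.ofReal_neg]
  congr 1
  rw [setIntegral_eq_integral_of_forall_compl_eq_zero, setIntegral_eq_integral_of_forall_compl_eq_zero]
  · have := integral_mul_deriv_eq_deriv_mul_of_integrable (u := φ) (v := p) (u' := deriv φ)
      (v' := deriv p) (fun x _ => (hφ.differentiable (by simp) x).hasDerivAt)
      (fun x _ => (hp.differentiable (by simp) x).hasDerivAt)
      ((hφ.continuous.mul hdp).integrable_of_hasCompactSupport hc.mul_right)
      ((hdφ.mul hp.continuous).integrable_of_hasCompactSupport hc.deriv.mul_right)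
      ((hφ.continuous.mul hp.continuous).integrable_of_hasCompactSupport hc.mul_right)
    rw [this, neg_neg]
  · intro x hx
    rw [image_eq_zero_of_notMem_tsupport fun h => hx (hs h), zero_mul]
  · intro x hx
    rw [deriv_eq_zero_of_notMem_tsupport fun h => hx (hs h), zero_mul]

theorem memLp_radialMeasure_ofReal {p : ℝ → ℝ} (hp : Continuous p) (hc : HasCompactSupport p) :
    MemLp (fun r => (p r : ℂ)) 2 radialMeasure :=
  (Complex.continuous_ofReal.comp hp).memLp_of_hasCompactSupport
    (hc.comp_left (g := Complex.ofReal) Complex.ofReal_zero)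

/-- `l = 0`, or `p` is divisible by `r`. -/
def VanishesAtZero (l : ℤ) (p : ℝ → ℝ) : Prop :=
  l = 0 ∨ ∃ s : ℝ → ℝ, Continuous s ∧ ∀ r, p r = r * s r

/-- A `C¹` function with compact support, vanishing at `0` if `l ≠ 0`, as an element of `H_l`. -/
noncomputable def HRad.ofReal (l : ℤ) (p : ℝ → ℝ) (hp : ContDiff ℝ 1 p) (hc : HasCompactSupport p)
    (h0 : VanishesAtZero l p) : HRad l where
  toFun r := p r
  dr r := ((deriv p r : ℝ) : ℂ)
  memLp_toFun := memLp_radialMeasure_ofReal hp.continuous hc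
  memLp_dr := memLp_radialMeasure_ofReal (hp.continuous_deriv le_rfl) hc.deriv
  memLp_div := by
    rcases h0 with rfl | ⟨s, hs, hps⟩
    · simp
    · have hsc : HasCompactSupport s := by
        refine HasCompactSupport.of_support_subset_isCompact (hc.isCompact.insert 0) fun x hx => ?_
        rcases eq_or_ne x 0 with rfl | hx0
        · exact mem_insert _ _
        · refine mem_insert_of_mem _ (subset_tsupport _ ?_)
          rw [Function.mem_support, hps]
          exact mul_ne_zero hx0 hx
      refine ((memLp_radialMeasure_ofReal hs hsc).const_mul (l : ℂ)).ae_eq ?_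
      refine ae_radialMeasure_iff.2 (Eventually.of_forall fun r (hr : 0 < r) => ?_)
      have : (r : ℂ) ≠ 0 := by exact_mod_cast hr.ne'
      simp only [hps]
      push_cast
      field_simp
  isWeakDeriv φ hφ hcφ hs := integral_Ioi_deriv_smul_ofReal hp hφ hcφ hs

/-! ### Truncated solutions -/

/-- A smooth cutoff on `ℝ` at scale `1`. -/
theorem exists_cutoff : ∃ (χ : ℝ → ℝ) (B : ℝ), 0 < B ∧ ContDiff ℝ (⊤ : ℕ∞) χ ∧
    (∀ x, 0 ≤ χ x) ∧ (∀ x, χ x ≤ 1) ∧ (∀ x, |x| ≤ 1 → χ x = 1) ∧ (∀ x, 2 ≤ |x| → χ x = 0) ∧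
    (∀ x, |deriv χ x| ≤ B) ∧ HasCompactSupport χ := by
  let b : ContDiffBump (0 : ℝ) := ⟨1, 2, one_pos, one_lt_two⟩
  have hb : ContDiff ℝ (⊤ : ℕ∞) b := b.contDiff
  obtain ⟨B, hB⟩ := (hb.continuous_deriv (by simp)).bounded_above_of_compact_support
    b.hasCompactSupport.deriv
  exact ⟨b, max B 1, by positivity, hb, fun x => b.nonneg, fun x => b.le_one,
    fun x hx => b.one_of_mem_closedBall (by simpa [Real.dist_eq] using hx),
    fun x hx => b.zero_of_le_dist (by simpa [Real.dist_eq] using hx),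
    fun x => (hB x).trans (le_max_left _ _), b.hasCompactSupport⟩

/-- Smooth cutoffs on the half-line at every scale `R`, with slope of order `1 / R`. -/
theorem exists_radial_cutoff : ∃ B : ℝ, 0 < B ∧ ∀ R : ℝ, 0 < R → ∃ η : ℝ → ℝ,
    ContDiff ℝ 1 η ∧ HasCompactSupport η ∧ (∀ r, 0 ≤ η r) ∧ (∀ r, η r ≤ 1) ∧
    (∀ r, 0 < r → r ≤ R → η r = 1) ∧ (∀ r, 2 * R ≤ r → η r = 0) ∧
    (∀ r, |deriv η r| ≤ B / R) ∧ (∀ r, 0 < r → r ∉ Icc R (2 * R) → deriv η r = 0) := by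
  obtain ⟨χ, B, hB, hχ, hχ0, hχ1, hχone, hχzero, hχB, -⟩ := exists_cutoff
  refine ⟨B, hB, fun R hR => ⟨fun r => χ (r / R),
    (hχ.of_le (by exact_mod_cast le_top)).comp (contDiff_id.div_const R), ?_,
    fun r => hχ0 _, fun r => hχ1 _, ?_, ?_, ?_, ?_⟩⟩
  · refine HasCompactSupport.of_support_subset_isCompact
      (isCompact_Icc : IsCompact (Icc (-(2 * R)) (2 * R))) fun x hx => ?_
    by_contra h
    refine hx (hχzero _ ?_)
    rw [abs_div, abs_of_pos hR, le_div_iff₀ hR]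
    by_contra h'
    exact h (abs_le.1 (not_le.1 h').le)
  · intro r hr hrR
    exact hχone _ (by rw [abs_of_pos (by positivity)]; exact (div_le_one hR).2 hrR)
  · intro r hr
    exact hχzero _ (by rw [abs_div, abs_of_pos hR, le_div_iff₀ hR]; exact hr.trans (le_abs_self r))
  · intro r
    have h1 := (hχ.differentiable (by simp) (r / R)).hasDerivAt
    have h2 : HasDerivAt (fun r => χ (r / R)) (deriv χ (r / R) / R) r :=
      (h1.comp r ((hasDerivAt_id r).div_const R)).congr_deriv (by ring)
    rw [h2.deriv, abs_div, abs_of_pos hR]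
    exact div_le_div_of_nonneg_right (hχB _) hR.le
  · intro r hr hrm
    rcases lt_or_ge r R with h1 | h1
    · have h3 : (fun r => χ (r / R)) =ᶠ[𝓝 r] fun _ => 1 := by
        filter_upwards [Ioo_mem_nhds hr h1] with x hx
        refine hχone _ ?_
        rw [abs_of_pos (div_pos hx.1 hR)]; exact (div_le_one hR).2 hx.2.le
      rw [h3.deriv_eq, deriv_const]
    · have h2 : 2 * R < r := not_le.1 fun h2 => hrm ⟨h1, h2⟩
      have h3 : (fun r => χ (r / R)) =ᶠ[𝓝 r] fun _ => 0 := by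
        filter_upwards [lt_mem_nhds h2] with x hx
        refine hχzero _ ?_
        rw [abs_div, abs_of_pos hR, le_div_iff₀ hR]; exact hx.le.trans (le_abs_self x)
      rw [h3.deriv_eq, deriv_const]

theorem VanishesAtZero.mul_left {l : ℤ} {p χ : ℝ → ℝ} (h : VanishesAtZero l p)
    (hχ : Continuous χ) : VanishesAtZero l fun r => χ r * p r := by
  rcases h with h | ⟨s, hs, hps⟩
  · exact Or.inl h
  · exact Or.inr ⟨fun r => χ r * s r, hχ.mul hs, fun r => by simp only [hps]; ring⟩

theorem integral_radialMeasure_le {h : ℝ → ℝ} {a b K : ℝ} (hab : a ≤ b) (hK0 : 0 ≤ K)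
    (h0 : ∀ r, 0 ≤ h r) (hz : ∀ r, 0 < r → r ∉ Icc a b → h r = 0)
    (hK : ∀ r, 0 < r → r ∈ Icc a b → r * h r ≤ K) :
    ∫ r, h r ∂radialMeasure ≤ K * (b - a) := by
  have hi : Integrable ((Icc a b).indicator fun _ => K) :=
    (integrable_indicator_iff measurableSet_Icc).2 (integrableOn_const measure_Icc_lt_top.ne)
  calc ∫ r, h r ∂radialMeasure = ∫ r in Ioi (0 : ℝ), r • h r := integral_radialMeasure h
    _ ≤ ∫ r in Ioi (0 : ℝ), (Icc a b).indicator (fun _ => K) r := by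
        refine integral_mono_of_nonneg ?_ hi.integrableOn ?_
        · filter_upwards [ae_restrict_mem measurableSet_Ioi] with r (hr : 0 < r)
          exact mul_nonneg hr.le (h0 r)
        · filter_upwards [ae_restrict_mem measurableSet_Ioi] with r (hr : 0 < r)
          by_cases hrm : r ∈ Icc a b
          · rw [indicator_of_mem hrm]; exact hK r hr hrm
          · rw [indicator_of_notMem hrm, hz r hr hrm, smul_zero]
    _ ≤ ∫ r, (Icc a b).indicator (fun _ => K) r :=
        setIntegral_le_integral hi (Eventually.of_forall fun r => indicator_nonneg (fun _ _ => hK0) _)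
    _ = K * (b - a) := by
        rw [integral_indicator measurableSet_Icc, setIntegral_const]
        simp [hab, mul_comm]

theorem le_integral_radialMeasure {h k : ℝ → ℝ} {a b : ℝ} (ha : 0 < a)
    (hi : Integrable h radialMeasure) (h0 : ∀ r, 0 ≤ h r) (hk : IntegrableOn k (Icc a b))
    (hkh : ∀ r ∈ Icc a b, k r ≤ r * h r) : ∫ r in Icc a b, k r ≤ ∫ r, h r ∂radialMeasure := by
  have hsub : Icc a b ⊆ Ioi 0 := fun r hr => ha.trans_le hr.1
  have hi' := integrable_radialMeasure_iff.1 hi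
  rw [integral_radialMeasure]
  refine (setIntegral_mono_on hk (hi'.mono_set hsub) measurableSet_Icc hkh).trans ?_
  refine setIntegral_mono_set hi' ?_ hsub.eventuallyLE
  filter_upwards [ae_restrict_mem measurableSet_Ioi] with r (hr : 0 < r)
  exact mul_nonneg hr.le (h0 r)

section Truncation

variable {m : ℤ} {ν : ℝ} {p q η : ℝ → ℝ}

theorem massRad_ofReal {P Q : ℝ → ℝ} (hP : ContDiff ℝ 1 P) (hPc : HasCompactSupport P)
    (hP0 : VanishesAtZero m P) (hQ : ContDiff ℝ 1 Q) (hQc : HasCompactSupport Q)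
    (hQ0 : VanishesAtZero (m + 1) Q) :
    massRad (HRad.ofReal m P hP hPc hP0) (HRad.ofReal (m + 1) Q hQ hQc hQ0)
      = ∫ r, (P r ^ 2 + Q r ^ 2) ∂radialMeasure := by
  simp only [massRad, HRad.ofReal, Complex.norm_real, Real.norm_eq_abs, sq_abs]

theorem quarticRad_ofReal {P Q : ℝ → ℝ} (hP : ContDiff ℝ 1 P) (hPc : HasCompactSupport P)
    (hP0 : VanishesAtZero m P) (hQ : ContDiff ℝ 1 Q) (hQc : HasCompactSupport Q)
    (hQ0 : VanishesAtZero (m + 1) Q) (lp lm l0 : ℝ) :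
    4 * quarticRad lp lm l0 (HRad.ofReal m P hP hPc hP0) (HRad.ofReal (m + 1) Q hQ hQc hQ0)
      = ∫ r, (lp * P r ^ 4 + lm * Q r ^ 4 + 2 * l0 * P r ^ 2 * Q r ^ 2) ∂radialMeasure := by
  have h4 : ∀ x : ℝ, |x| ^ 4 = x ^ 4 := fun x => by
    rw [← abs_pow]; exact abs_of_nonneg (by positivity)
  simp only [quarticRad, HRad.ofReal, Complex.norm_real, Real.norm_eq_abs, sq_abs, h4]
  ring

/-- By the product rule and the system, only the terms in which the derivative falls on the cutoff
survive. -/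
theorem IsRadialSolution.defectRad_mul (h : IsRadialSolution m ν p q) (hη : ContDiff ℝ 1 η)
    (hP : ContDiff ℝ 1 fun r => η r * p r) (hPc : HasCompactSupport fun r => η r * p r)
    (hP0 : VanishesAtZero m fun r => η r * p r) (hQ : ContDiff ℝ 1 fun r => η r * q r)
    (hQc : HasCompactSupport fun r => η r * q r)
    (hQ0 : VanishesAtZero (m + 1) fun r => η r * q r) :
    defectRad ν (HRad.ofReal m _ hP hPc hP0) (HRad.ofReal (m + 1) _ hQ hQc hQ0)
      = ∫ r, (deriv η r) ^ 2 * (p r ^ 2 + q r ^ 2) ∂radialMeasure := by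
  refine integral_congr_ae (ae_radialMeasure_iff.2 (Eventually.of_forall fun r hr => ?_))
  have hr' : (r : ℂ) ≠ 0 := by exact_mod_cast (ne_of_gt hr : r ≠ 0)
  have hηr := (hη.differentiable (by simp) r).hasDerivAt
  have d1 : deriv (fun r => η r * p r) r = _ := (hηr.mul (h.hasDerivAt_fst r hr)).deriv
  have d2 : deriv (fun r => η r * q r) r = _ := (hηr.mul (h.hasDerivAt_snd r hr)).deriv
  have e1 : ((deriv (fun r => η r * q r) r : ℝ) : ℂ)
      + ((m + 1 : ℤ) : ℂ) / (r : ℂ) * ((η r * q r : ℝ) : ℂ) + ν * ((η r * p r : ℝ) : ℂ)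
      = ((deriv η r * q r : ℝ) : ℂ) := by
    rw [d2]
    push_cast
    field_simp
    ring
  have e2 : ((deriv (fun r => η r * p r) r : ℝ) : ℂ)
      - (m : ℂ) / (r : ℂ) * ((η r * p r : ℝ) : ℂ) - ν * ((η r * q r : ℝ) : ℂ)
      = ((deriv η r * p r : ℝ) : ℂ) := by
    rw [d1]
    push_cast
    field_simp
    ring
  simp only [HRad.raise, HRad.lower, HRad.ofReal, e1, e2, Complex.norm_real, Real.norm_eq_abs,
    sq_abs]
  ring

theorem quartic_lower_bound {lp lm l0 μ : ℝ} (h1 : 2 * μ ≤ lp) (h2 : 2 * μ ≤ lm) (hμ : 0 ≤ μ)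
    (hl0 : 0 ≤ l0) (x y : ℝ) :
    μ * (x ^ 2 + y ^ 2) ^ 2 ≤ lp * x ^ 4 + lm * y ^ 4 + 2 * l0 * x ^ 2 * y ^ 2 := by
  have b1 := mul_le_mul_of_nonneg_right h1 (by positivity : 0 ≤ x ^ 4)
  have b2 := mul_le_mul_of_nonneg_right h2 (by positivity : 0 ≤ y ^ 4)
  have b3 : 0 ≤ 2 * l0 * x ^ 2 * y ^ 2 := by positivity
  have b4 : 0 ≤ μ * (x ^ 2 - y ^ 2) ^ 2 := by positivity
  nlinarith

/-- The slope squared is at most `(B/R)²`, the density at most `C`, and the transition region has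
length `R`. -/
theorem integral_cutoff_deriv_le {B C R : ℝ} (hB : 0 < B) (hR : 0 < R) (hC0 : 0 ≤ C)
    (hC : ∀ r, 0 ≤ r → r * (p r ^ 2 + q r ^ 2) ≤ C) (hηB : ∀ r, |deriv η r| ≤ B / R)
    (hηd : ∀ r, 0 < r → r ∉ Icc R (2 * R) → deriv η r = 0) :
    ∫ r, (deriv η r) ^ 2 * (p r ^ 2 + q r ^ 2) ∂radialMeasure ≤ B ^ 2 * C / R := by
  have := integral_radialMeasure_le (h := fun r => (deriv η r) ^ 2 * (p r ^ 2 + q r ^ 2))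
    (a := R) (b := 2 * R) (K := (B / R) ^ 2 * C) (by linarith) (by positivity)
    (fun r => by positivity) (fun r hr hrm => by simp [hηd r hr hrm]) (fun r hr _ => ?_)
  · refine this.trans (le_of_eq ?_)
    field_simp
    ring
  · have h1 : (deriv η r) ^ 2 ≤ (B / R) ^ 2 := by
      rw [← sq_abs]
      exact pow_le_pow_left₀ (abs_nonneg _) (hηB r) 2
    calc r * ((deriv η r) ^ 2 * (p r ^ 2 + q r ^ 2))
        = (deriv η r) ^ 2 * (r * (p r ^ 2 + q r ^ 2)) := by ring
      _ ≤ (B / R) ^ 2 * C := mul_le_mul h1 (hC r hr.le) (by positivity) (by positivity)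

theorem integral_cutoff_sq_le {C R : ℝ} (hR : 0 < R) (hC0 : 0 ≤ C)
    (hC : ∀ r, 0 ≤ r → r * (p r ^ 2 + q r ^ 2) ≤ C) (hη0 : ∀ r, 0 ≤ η r) (hη1 : ∀ r, η r ≤ 1)
    (hηzero : ∀ r, 2 * R ≤ r → η r = 0) :
    ∫ r, ((η r * p r) ^ 2 + (η r * q r) ^ 2) ∂radialMeasure ≤ 2 * C * R := by
  refine (integral_radialMeasure_le (a := 0) (b := 2 * R) (K := C) (by linarith) hC0
    (fun r => by positivity) (fun r hr hrm => ?_) (fun r hr _ => ?_)).trans (le_of_eq (by ring))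
  · rw [hηzero r (not_lt.1 fun h' => hrm ⟨hr.le, h'.le⟩)]
    simp
  · have h1 : η r ^ 2 ≤ 1 := pow_le_one₀ (hη0 _) (hη1 _)
    have h2 : 0 ≤ r * (p r ^ 2 + q r ^ 2) := by positivity
    calc r * ((η r * p r) ^ 2 + (η r * q r) ^ 2) = η r ^ 2 * (r * (p r ^ 2 + q r ^ 2)) := by ring
      _ ≤ 1 * (r * (p r ^ 2 + q r ^ 2)) := mul_le_mul_of_nonneg_right h1 h2
      _ ≤ C := by rw [one_mul]; exact hC r hr.le

theorem integral_cutoff_sq_pos {c r₀ R : ℝ} (hc : 0 < c) (hr₀ : 0 < r₀) (hR : r₀ < R)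
    (hbd : ∀ r, r₀ ≤ r → c ≤ r * (p r ^ 2 + q r ^ 2)) (hη : Continuous η)
    (hηc : HasCompactSupport η) (hp : Continuous p) (hq : Continuous q)
    (hηone : ∀ r, 0 < r → r ≤ R → η r = 1) :
    0 < ∫ r, ((η r * p r) ^ 2 + (η r * q r) ^ 2) ∂radialMeasure := by
  have hi : Integrable (fun r => η r * (η r * (p r ^ 2 + q r ^ 2))) radialMeasure :=
    Continuous.integrable_of_hasCompactSupport (by fun_prop) hηc.mul_right
  have hi' : Integrable (fun r => (η r * p r) ^ 2 + (η r * q r) ^ 2) radialMeasure :=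
    hi.congr (Eventually.of_forall fun r => by ring)
  have := le_integral_radialMeasure (k := fun _ => c) hr₀ (b := R) hi'
    (fun r => by positivity) (integrableOn_const measure_Icc_lt_top.ne) (fun r hr => ?_)
  · refine lt_of_lt_of_le ?_ this
    rw [setIntegral_const, smul_eq_mul]
    have : volume.real (Icc r₀ R) = R - r₀ := by simp [hR.le]
    rw [this]
    exact mul_pos (sub_pos.2 hR) hc
  · rw [hηone r (hr₀.trans_le hr.1) hr.2, one_mul, one_mul]
    exact hbd r hr.1

/-- The quartic integrand is at least `μ (p² + q²)²`, which times the weight `r` is at least `μ c² /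
r`. Its integral over `[r₀, R]` is the logarithm. -/
theorem integral_cutoff_quartic_ge {c r₀ R : ℝ} (hc : 0 < c) (hr₀ : 0 < r₀) (hR : r₀ < R)
    (hbd : ∀ r, r₀ ≤ r → c ≤ r * (p r ^ 2 + q r ^ 2)) (hη : Continuous η)
    (hηc : HasCompactSupport η) (hp : Continuous p) (hq : Continuous q)
    (hηone : ∀ r, 0 < r → r ≤ R → η r = 1) {lp lm l0 μ : ℝ} (h1 : 2 * μ ≤ lp) (h2 : 2 * μ ≤ lm)
    (hμ : 0 < μ) (hl0 : 0 < l0) :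
    μ * c ^ 2 * Real.log (R / r₀) ≤ ∫ r, (lp * (η r * p r) ^ 4 + lm * (η r * q r) ^ 4
      + 2 * l0 * (η r * p r) ^ 2 * (η r * q r) ^ 2) ∂radialMeasure := by
  have hi : Integrable (fun r => η r * (η r ^ 3 * (lp * p r ^ 4 + lm * q r ^ 4
      + 2 * l0 * p r ^ 2 * q r ^ 2))) radialMeasure :=
    Continuous.integrable_of_hasCompactSupport (by fun_prop) hηc.mul_right
  have hi' : Integrable (fun r => lp * (η r * p r) ^ 4 + lm * (η r * q r) ^ 4
      + 2 * l0 * (η r * p r) ^ 2 * (η r * q r) ^ 2) radialMeasure :=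
    hi.congr (Eventually.of_forall fun r => by ring)
  have hk : IntegrableOn (fun r => μ * c ^ 2 * r⁻¹) (Icc r₀ R) :=
    ((continuousOn_inv₀.mono fun r hr => ne_of_gt (hr₀.trans_le hr.1)).integrableOn_compact
      isCompact_Icc).const_mul _
  have h0 := fun x y => quartic_lower_bound h1 h2 hμ.le hl0.le x y
  have := le_integral_radialMeasure hr₀ hi' (fun r => le_trans (by positivity) (h0 _ _)) hk
    (fun r hr => ?_)
  · refine le_trans (le_of_eq ?_) this
    rw [integral_const_mul, integral_Icc_eq_integral_Ioc, ← intervalIntegral.integral_of_le hR.le,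
      integral_inv_of_pos hr₀ (hr₀.trans hR)]
  · have hr0 : 0 < r := hr₀.trans_le hr.1
    rw [hηone r hr0 hr.2, one_mul, one_mul, mul_inv_le_iff₀ hr0]
    have h3 : c ^ 2 ≤ (r * (p r ^ 2 + q r ^ 2)) ^ 2 := pow_le_pow_left₀ hc.le (hbd r hr.1) 2
    calc μ * c ^ 2 ≤ μ * (r * (p r ^ 2 + q r ^ 2)) ^ 2 := mul_le_mul_of_nonneg_left h3 hμ.le
      _ = r ^ 2 * (μ * (p r ^ 2 + q r ^ 2) ^ 2) := by ring
      _ ≤ r ^ 2 * (lp * p r ^ 4 + lm * q r ^ 4 + 2 * l0 * p r ^ 2 * q r ^ 2) :=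
          mul_le_mul_of_nonneg_left (h0 _ _) (sq_nonneg r)
      _ = _ := by ring

end Truncation

/-- The defect times the mass is at most `(B² C / R) (2 C R) = 2 B² C²`, independently of `R`, while
the quartic term grows like `log R`. -/
theorem IsRadialSolution.infEnergyRad_lt {m : ℤ} {ν : ℝ} {p q : ℝ → ℝ}
    (h : IsRadialSolution m ν p q) (hν : 0 < ν) (hp : ContDiff ℝ 1 p) (hq : ContDiff ℝ 1 q)
    (hp0 : VanishesAtZero m p) (hq0 : VanishesAtZero (m + 1) q)
    (hne : ∃ r, 0 < r ∧ 0 < p r ^ 2 + q r ^ 2) {lp lm l0 ρ : ℝ} (hlp : 0 < lp) (hlm : 0 < lm)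
    (hl0 : 0 < l0) (hρ : 0 < ρ) :
    infEnergyRad m ν lp lm l0 ρ < infEnergyLinRad m ν ρ := by
  obtain ⟨r₁, hr₁, hpos⟩ := hne
  obtain ⟨r₀, c, C₁, hr₀, hc, hbd⟩ := h.exists_bounds_atTop hν hr₁ hpos
  obtain ⟨B, hB, hcut⟩ := exists_radial_cutoff
  obtain ⟨C, hC0, hC⟩ : ∃ C, 0 ≤ C ∧ ∀ r, 0 ≤ r → r * (p r ^ 2 + q r ^ 2) ≤ C := by
    have hGc : Continuous fun r => r * (p r ^ 2 + q r ^ 2) :=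
      continuous_id.mul ((hp.continuous.pow 2).add (hq.continuous.pow 2))
    obtain ⟨C₂, hC₂⟩ := (isCompact_Icc : IsCompact (Icc 0 r₀)).bddAbove_image hGc.continuousOn
    refine ⟨max (max C₁ C₂) 0, le_max_right _ _, fun r hr => le_max_of_le_left ?_⟩
    rcases le_total r₀ r with h1 | h1
    · exact le_max_of_le_left (hbd r h1).2
    · exact le_max_of_le_right (hC₂ (mem_image_of_mem _ ⟨hr, h1⟩))
  obtain ⟨μ, hμ, hμp, hμm⟩ : ∃ μ, 0 < μ ∧ 2 * μ ≤ lp ∧ 2 * μ ≤ lm :=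
    ⟨min lp lm / 2, half_pos (lt_min hlp hlm), by linarith [min_le_left lp lm],
      by linarith [min_le_right lp lm]⟩
  -- `T` is the value required of `log (R / r₀)`.
  obtain ⟨T, hT, hTA⟩ : ∃ T, 0 < T ∧ 2 * B ^ 2 * C ^ 2 < μ * c ^ 2 * T * ρ := by
    refine ⟨(2 * B ^ 2 * C ^ 2 + 1) / (μ * c ^ 2 * ρ), by positivity, ?_⟩
    rw [show μ * c ^ 2 * ((2 * B ^ 2 * C ^ 2 + 1) / (μ * c ^ 2 * ρ)) * ρ = 2 * B ^ 2 * C ^ 2 + 1 by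
      field_simp]
    exact lt_add_one _
  obtain ⟨R, hRr, hRT⟩ : ∃ R, r₀ < R ∧ Real.log (R / r₀) = T :=
    ⟨r₀ * Real.exp T, lt_mul_of_one_lt_right hr₀ (Real.one_lt_exp_iff.2 hT), by
      rw [mul_div_cancel_left₀ _ hr₀.ne', Real.log_exp]⟩
  have hR : 0 < R := hr₀.trans hRr
  obtain ⟨η, hη, hηc, hη0, hη1, hηone, hηzero, hηB, hηd⟩ := hcut R hR
  have hP : ContDiff ℝ 1 fun r => η r * p r := hη.mul hp
  have hQ : ContDiff ℝ 1 fun r => η r * q r := hη.mul hq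
  have hPc : HasCompactSupport fun r => η r * p r := hηc.mul_right
  have hQc : HasCompactSupport fun r => η r * q r := hηc.mul_right
  have hP0 := hp0.mul_left hη.continuous
  have hQ0 := hq0.mul_left hη.continuous
  have hmass_pos := integral_cutoff_sq_pos hc hr₀ hRr (fun r hr => (hbd r hr).1) hη.continuous hηc
    hp.continuous hq.continuous hηone
  refine infEnergyRad_lt_of_defectRad_mul_massRad_lt hρ
    (HRad.ofReal m _ hP hPc hP0) (HRad.ofReal (m + 1) _ hQ hQc hQ0) ?_ ?_
  · rw [massRad_ofReal]
    exact hmass_pos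
  · rw [massRad_ofReal, quarticRad_ofReal, h.defectRad_mul hη]
    refine lt_of_le_of_lt (mul_le_mul (integral_cutoff_deriv_le hB hR hC0 hC hηB hηd)
      (integral_cutoff_sq_le hR hC0 hC hη0 hη1 hηzero) hmass_pos.le (by positivity)) ?_
    refine lt_of_lt_of_le ?_ (mul_le_mul_of_nonneg_right
      (integral_cutoff_quartic_ge hc hr₀ hRr (fun r hr => (hbd r hr).1) hη.continuous hηc
        hp.continuous hq.continuous hηone hμp hμm hμ hl0) hρ.le)
    rw [hRT]
    refine lt_of_le_of_lt (le_of_eq ?_) hTA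
    field_simp

/-! ### Bessel functions of integer order -/

/-- The `j`-th term of the power series of the Bessel–Clifford function of order `k`. -/
noncomputable def besselTerm (k j : ℕ) (t : ℝ) : ℝ :=
  (-1) ^ j * t ^ j / (j.factorial * (j + k).factorial)

/-- The Bessel–Clifford function `∑ (-t)^j / (j! (j + k)!)`; the Bessel function of order `k` is
`J_k(x) = (x / 2)^k besselClifford k (x² / 4)`. -/
noncomputable def besselClifford (k : ℕ) (t : ℝ) : ℝ := ∑' j, besselTerm k j t

theorem abs_besselTerm_le (k j : ℕ) (t : ℝ) : |besselTerm k j t| ≤ |t| ^ j / j.factorial := by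
  have h1 : (0 : ℝ) < j.factorial := by positivity
  have h2 : (1 : ℝ) ≤ (j + k).factorial := by exact_mod_cast (j + k).factorial_pos
  rw [besselTerm, abs_div, abs_mul, abs_pow, abs_pow, abs_neg, abs_one, one_pow, one_mul,
    abs_of_pos (by positivity : (0 : ℝ) < j.factorial * (j + k).factorial)]
  exact div_le_div_of_nonneg_left (by positivity) h1 (le_mul_of_one_le_right h1.le h2)

theorem summable_besselTerm (k : ℕ) (t : ℝ) : Summable fun j => besselTerm k j t :=
  Summable.of_norm_bounded (Real.summable_pow_div_factorial |t|) fun j => abs_besselTerm_le k j t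

theorem succ_mul_besselTerm_succ (k j : ℕ) (t : ℝ) :
    (j + 1 : ℝ) * besselTerm k (j + 1) t = -(t * besselTerm (k + 1) j t) := by
  have h : (j + 1 + k).factorial = (j + (k + 1)).factorial := by congr 1; ring
  rw [besselTerm, besselTerm, h, Nat.factorial_succ j]
  push_cast
  field_simp
  ring

theorem besselTerm_eq (k j : ℕ) (t : ℝ) :
    besselTerm k j t = (j + (k + 1)) * besselTerm (k + 1) j t := by
  rw [besselTerm, besselTerm, ← Nat.add_assoc j k 1, Nat.factorial_succ (j + k)]
  have : (j + (k + 1) : ℝ) ≠ 0 := by positivity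
  push_cast
  field_simp
  ring

/-- Write `1/(j+k)!` as `(j + (k+1)) / (j+k+1)!`. The part with factor `j` cancels against `j!` and,
after an index shift, becomes the series of order `k + 2`. -/
theorem besselClifford_recurrence (k : ℕ) (t : ℝ) :
    besselClifford k t = (k + 1) * besselClifford (k + 1) t - t * besselClifford (k + 2) t := by
  have h1 := summable_besselTerm k t
  have h2 := (summable_besselTerm (k + 1) t).mul_left (k + 1 : ℝ)
  have h3 : Summable fun j : ℕ => (j : ℝ) * besselTerm (k + 1) j t :=
    (h1.sub h2).congr fun j => by rw [besselTerm_eq]; ring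
  have h4 : ∑' j : ℕ, (j : ℝ) * besselTerm (k + 1) j t = -(t * besselClifford (k + 2) t) := by
    rw [h3.tsum_eq_zero_add, besselClifford, ← tsum_mul_left, ← tsum_neg]
    simp only [Nat.cast_zero, zero_mul, zero_add, Nat.cast_add, Nat.cast_one,
      succ_mul_besselTerm_succ]
  calc besselClifford k t
      = ∑' j : ℕ, ((k + 1 : ℝ) * besselTerm (k + 1) j t + (j : ℝ) * besselTerm (k + 1) j t) := by
        refine tsum_congr fun j => ?_
        rw [besselTerm_eq]; ring
    _ = _ := by
        rw [h2.tsum_add h3, h4, tsum_mul_left]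
        simp only [besselClifford]
        ring

theorem hasDerivAt_besselTerm_succ (k j : ℕ) (t : ℝ) :
    HasDerivAt (besselTerm k (j + 1)) (-besselTerm (k + 1) j t) t := by
  have h : (j + 1 + k).factorial = (j + (k + 1)).factorial := by congr 1; ring
  refine ((((hasDerivAt_pow (j + 1) t).const_mul ((-1 : ℝ) ^ (j + 1))).div_const
    ((j + 1).factorial * (j + 1 + k).factorial : ℝ))).congr_deriv ?_
  rw [besselTerm, h, Nat.factorial_succ j]
  push_cast
  field_simp
  ring

theorem hasDerivAt_besselClifford (k : ℕ) (t : ℝ) :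
    HasDerivAt (besselClifford k) (-besselClifford (k + 1) t) t := by
  -- On the ball of radius `A`, which contains `t`, the exponential series at `A` dominates the
  -- differentiated terms.
  set A := |t| + 1
  have hA : 0 ≤ A := by positivity
  have h0 : ∀ s, besselClifford k s = besselTerm k 0 s + ∑' j, besselTerm k (j + 1) s := fun s =>
    (summable_besselTerm k s).tsum_eq_zero_add
  have hconst : ∀ s, besselTerm k 0 s = ((k.factorial : ℝ))⁻¹ := fun s => by simp [besselTerm]
  have h1 : HasDerivAt (fun s => ∑' j, besselTerm k (j + 1) s)
      (∑' j, -besselTerm (k + 1) j t) t := by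
    refine hasDerivAt_tsum_of_isPreconnected (Real.summable_pow_div_factorial A)
      (t := Metric.ball 0 A) Metric.isOpen_ball (convex_ball 0 A).isPreconnected
      (fun j y _ => hasDerivAt_besselTerm_succ k j y) (fun j y hy => ?_)
      (y₀ := t) (by simp [A]) ((summable_nat_add_iff 1).2 (summable_besselTerm k t)) (by simp [A])
    rw [norm_neg, Real.norm_eq_abs]
    refine (abs_besselTerm_le (k + 1) j y).trans ?_
    have : |y| ≤ A := by simpa using (mem_ball_zero_iff.1 hy).le
    gcongr
  rw [tsum_neg] at h1
  have h2 := h1.const_add ((k.factorial : ℝ))⁻¹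
  refine h2.congr_of_eventuallyEq (Eventually.of_forall fun s => ?_)
  rw [h0, hconst]

theorem continuous_besselClifford (k : ℕ) : Continuous (besselClifford k) :=
  continuous_iff_continuousAt.2 fun t => (hasDerivAt_besselClifford k t).continuousAt

theorem contDiff_besselClifford (k : ℕ) : ContDiff ℝ 1 (besselClifford k) := by
  refine contDiff_one_iff_deriv.2
    ⟨fun t => (hasDerivAt_besselClifford k t).differentiableAt, ?_⟩
  rw [show deriv (besselClifford k) = fun t => -besselClifford (k + 1) t from
    funext fun t => (hasDerivAt_besselClifford k t).deriv]
  exact (continuous_besselClifford _).neg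

theorem besselClifford_zero (k : ℕ) : besselClifford k 0 = ((k.factorial : ℝ))⁻¹ := by
  rw [besselClifford, tsum_eq_single 0]
  · simp [besselTerm]
  · intro j hj
    simp [besselTerm, hj]

/-! ### Bessel solutions of the radial system -/

/-- A multiple of `J_k(ν r)`. -/
noncomputable def radialBessel (ν : ℝ) (k : ℕ) (r : ℝ) : ℝ :=
  r ^ k * besselClifford k (ν ^ 2 / 4 * r ^ 2)

/-- The same multiple of `-J_{k+1}(ν r)`. -/
noncomputable def radialBesselSucc (ν : ℝ) (k : ℕ) (r : ℝ) : ℝ :=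
  -(ν / 2) * radialBessel ν (k + 1) r

theorem contDiff_radialBessel (ν : ℝ) (k : ℕ) : ContDiff ℝ 1 (radialBessel ν k) :=
  (contDiff_id.pow k).mul
    ((contDiff_besselClifford k).comp (contDiff_const.mul (contDiff_id.pow 2)))

theorem contDiff_radialBesselSucc (ν : ℝ) (k : ℕ) : ContDiff ℝ 1 (radialBesselSucc ν k) :=
  contDiff_const.mul (contDiff_radialBessel ν (k + 1))

/-- This is `J_k' = (k/x) J_k - J_{k+1}`. The companion below is `J_{k+1}' = J_k - ((k+1)/x)
J_{k+1}`, which rests on the three-term recurrence. -/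
theorem hasDerivAt_radialBessel (ν : ℝ) (k : ℕ) {r : ℝ} (hr : r ≠ 0) :
    HasDerivAt (radialBessel ν k)
      (k / r * radialBessel ν k r + ν * radialBesselSucc ν k r) r := by
  have h1 : HasDerivAt (fun r : ℝ => ν ^ 2 / 4 * r ^ 2) (ν ^ 2 / 2 * r) r := by
    refine ((hasDerivAt_pow 2 r).const_mul (ν ^ 2 / 4)).congr_deriv ?_
    push_cast
    ring
  have h2 := (hasDerivAt_pow k r).mul
    ((hasDerivAt_besselClifford k (ν ^ 2 / 4 * r ^ 2)).comp r h1)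
  refine h2.congr_deriv ?_
  simp only [radialBessel, radialBesselSucc, Function.comp]
  rcases k with _ | k
  · simp; ring
  · simp only [Nat.add_sub_cancel]
    field_simp
    ring

theorem hasDerivAt_radialBesselSucc (ν : ℝ) (k : ℕ) {r : ℝ} (hr : r ≠ 0) :
    HasDerivAt (radialBesselSucc ν k)
      (-((k + 1) / r * radialBesselSucc ν k r) - ν * radialBessel ν k r) r := by
  refine ((hasDerivAt_radialBessel ν (k + 1) hr).const_mul (-(ν / 2))).congr_deriv ?_
  simp only [radialBesselSucc, radialBessel, besselClifford_recurrence k]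
  push_cast
  field_simp
  ring

theorem isRadialSolution_radialBessel (ν : ℝ) (k : ℕ) :
    IsRadialSolution k ν (radialBessel ν k) (radialBesselSucc ν k) :=
  ⟨fun r hr => by simpa using hasDerivAt_radialBessel ν k hr.ne',
    fun r hr => by simpa using hasDerivAt_radialBesselSucc ν k hr.ne'⟩

/-- Swapping the components turns index `m` into `-1 - m`. -/
theorem IsRadialSolution.swap {m : ℤ} {ν : ℝ} {p q : ℝ → ℝ} (h : IsRadialSolution m ν p q) :
    IsRadialSolution (-1 - m) ν q fun r => -p r := by
  refine ⟨fun r hr => (h.hasDerivAt_snd r hr).congr_deriv ?_,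
    fun r hr => (h.hasDerivAt_fst r hr).neg.congr_deriv ?_⟩ <;>
  · push_cast
    ring

theorem vanishesAtZero_radialBessel (ν : ℝ) (k : ℕ) {l : ℤ} (hl : k = 0 → l = 0) :
    VanishesAtZero l (radialBessel ν k) := by
  rcases k with _ | k
  · exact Or.inl (hl rfl)
  · refine Or.inr ⟨fun r => r ^ k * besselClifford (k + 1) (ν ^ 2 / 4 * r ^ 2), ?_, fun r => ?_⟩
    · exact (continuous_id.pow k).mul
        ((continuous_besselClifford _).comp (continuous_const.mul (continuous_id.pow 2)))
    · rw [radialBessel]; ring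

theorem vanishesAtZero_radialBesselSucc (ν : ℝ) (k : ℕ) (l : ℤ) :
    VanishesAtZero l (radialBesselSucc ν k) :=
  (vanishesAtZero_radialBessel ν (k + 1) (by simp)).mul_left continuous_const

theorem exists_radialBessel_pos (ν : ℝ) (k : ℕ) : ∃ r, 0 < r ∧ 0 < radialBessel ν k r := by
  have hc : Continuous fun r : ℝ => besselClifford k (ν ^ 2 / 4 * r ^ 2) :=
    (continuous_besselClifford k).comp (continuous_const.mul (continuous_id.pow 2))
  have h0 : 0 < (fun r : ℝ => besselClifford k (ν ^ 2 / 4 * r ^ 2)) 0 := by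
    simp only [ne_eq, OfNat.ofNat_ne_zero, not_false_eq_true, zero_pow, mul_zero,
      besselClifford_zero]
    positivity
  obtain ⟨ε, hε, hball⟩ := Metric.eventually_nhds_iff.1 (hc.continuousAt.eventually (lt_mem_nhds h0))
  refine ⟨ε / 2, half_pos hε, mul_pos (pow_pos (half_pos hε) k) (hball ?_)⟩
  rw [Real.dist_eq, sub_zero, abs_of_pos (half_pos hε)]
  exact half_lt_self hε

theorem infEnergyRad_lt_infEnergyLinRad {ν lp lm l0 ρ : ℝ} (hν : 0 < ν) (hlp : 0 < lp)
    (hlm : 0 < lm) (hl0 : 0 < l0) (hρ : 0 < ρ) (m : ℤ) :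
    infEnergyRad m ν lp lm l0 ρ < infEnergyLinRad m ν ρ := by
  rcases le_or_gt 0 m with hm | hm
  · obtain ⟨k, rfl⟩ := Int.eq_ofNat_of_zero_le hm
    obtain ⟨r, hr, hpos⟩ := exists_radialBessel_pos ν k
    exact (isRadialSolution_radialBessel ν k).infEnergyRad_lt hν (contDiff_radialBessel ν k)
      (contDiff_radialBesselSucc ν k) (vanishesAtZero_radialBessel ν k (by simp))
      (vanishesAtZero_radialBesselSucc ν k _) ⟨r, hr, by positivity⟩ hlp hlm hl0 hρ
  -- Negative indices come from the swapped solution of index `k = -1 - m`: `H_m` receives the order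
  -- `k + 1` and `H_{m+1} = H_{-k}` the order `k`. The latter need not vanish at `0` when `k = 0`,
  -- but then its index is `0` too.
  · obtain ⟨k, hk⟩ := Int.eq_ofNat_of_zero_le (by omega : 0 ≤ -1 - m)
    obtain rfl : m = -1 - (k : ℤ) := by omega
    obtain ⟨r, hr, hpos⟩ := exists_radialBessel_pos ν k
    have hv : VanishesAtZero (-1 - (k : ℤ) + 1) (radialBessel ν k) :=
      vanishesAtZero_radialBessel ν k (by intro h; simp [h])
    exact (isRadialSolution_radialBessel ν k).swap.infEnergyRad_lt hν
      (contDiff_radialBesselSucc ν k) (contDiff_radialBessel ν k).neg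
      (vanishesAtZero_radialBesselSucc ν k _)
      (by simpa using hv.mul_left (χ := fun _ => (-1 : ℝ)) continuous_const)
      ⟨r, hr, by rw [neg_sq]; positivity⟩ hlp hlm hl0 hρ

/-! ### Completing the square in the energy on `H¹(ℝ²)` -/

theorem H1.memLp_Dplus (u : H1) : MemLp u.Dplus 2 volume :=
  u.memLp_dx.add (u.memLp_dy.const_mul Complex.I)

theorem H1.memLp_Dminus (u : H1) : MemLp u.Dminus 2 volume :=
  u.memLp_dx.sub (u.memLp_dy.const_mul Complex.I)

/-- The squared `L²` norm of the defect of `(p, q)` in the first-order system `D⁻ q = -ν p`,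
`D⁺ p = ν q`. -/
noncomputable def defect (ν : ℝ) (p q : H1) : ℝ :=
  ∫ z, (‖q.Dminus z + ν * p z‖ ^ 2 + ‖p.Dplus z - ν * q z‖ ^ 2)

theorem mass_eq (p q : H1) : mass p q = ∫ z, (‖p z‖ ^ 2 + ‖q z‖ ^ 2) :=
  (integral_add (p.memLp_toFun.integrable_norm_pow (by norm_num))
    (q.memLp_toFun.integrable_norm_pow (by norm_num))).symm

/-- The kinetic energy is already expressed through `D⁺` and `D⁻`, so no integration by parts is
needed here, in contrast to the radial case. -/
theorem energyLin_eq (ν : ℝ) (p q : H1) :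
    energyLin ν p q = 1 / 4 * defect ν p q - ν ^ 2 / 4 * mass p q := by
  rw [defect, integral_completed_square q.memLp_Dminus p.memLp_Dplus p.memLp_toFun q.memLp_toFun,
    mass_eq, energyLin, kinetic, spinOrbit]
  simp only [mul_comm (conj _), add_comm (‖p.Dplus _‖ ^ 2)]
  ring

/-! ### Amplitude scaling and the criterion for strict inequality in the plane -/

theorem le_infEnergyLin (ν ρ : ℝ) :
    ((-(ν ^ 2 / 4 * ρ) : ℝ) : EReal) ≤ infEnergyLin ν ρ := by
  refine le_sInf ?_
  rintro e ⟨p, q, hM, rfl⟩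
  rw [EReal.coe_le_coe_iff, energyLin_eq, hM]
  have : 0 ≤ defect ν p q := integral_nonneg fun r => by positivity
  linarith

theorem IsWeakPartial.const_mul {e : ℝ × ℝ} {u g : ℝ × ℝ → ℂ} (h : IsWeakPartial e u g) (t : ℂ) :
    IsWeakPartial e (fun z => t * u z) fun z => t * g z := by
  intro φ hφ hc
  have := h φ hφ hc
  simp only [Complex.real_smul, mul_left_comm _ t] at this ⊢
  rw [integral_const_mul, integral_const_mul, ← mul_neg, this]

/-- The real multiple `t u`. -/
def H1.smul (t : ℝ) (u : H1) : H1 where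
  toFun z := t * u z
  dx z := t * u.dx z
  dy z := t * u.dy z
  memLp_toFun := u.memLp_toFun.const_mul _
  memLp_dx := u.memLp_dx.const_mul _
  memLp_dy := u.memLp_dy.const_mul _
  isWeakPartial_dx := u.isWeakPartial_dx.const_mul t
  isWeakPartial_dy := u.isWeakPartial_dy.const_mul t

theorem mass_smul (p q : H1) (t : ℝ) : mass (p.smul t) (q.smul t) = t ^ 2 * mass p q := by
  simp only [mass, H1.smul, norm_mul, Complex.norm_real, Real.norm_eq_abs, mul_pow, sq_abs]
  rw [integral_const_mul, integral_const_mul, mul_add]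

theorem defect_smul (ν : ℝ) (p q : H1) (t : ℝ) :
    defect ν (p.smul t) (q.smul t) = t ^ 2 * defect ν p q := by
  have h1 : ∀ z, (q.smul t).Dminus z + ν * (p.smul t) z = t * (q.Dminus z + ν * p z) := fun r => by
    simp only [H1.Dminus, H1.smul]; ring
  have h2 : ∀ z, (p.smul t).Dplus z - ν * (q.smul t) z = t * (p.Dplus z - ν * q z) := fun r => by
    simp only [H1.Dplus, H1.smul]; ring
  simp only [defect, h1, h2, norm_mul, Complex.norm_real, Real.norm_eq_abs, mul_pow, sq_abs]
  rw [← integral_const_mul]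
  congr 1; ext r; ring

theorem quartic_smul (lp lm l0 : ℝ) (p q : H1) (t : ℝ) :
    quartic lp lm l0 (p.smul t) (q.smul t) = t ^ 4 * quartic lp lm l0 p q := by
  have h4 : |t| ^ 4 = t ^ 4 := by rw [← abs_pow]; exact abs_of_nonneg (by positivity)
  simp only [quartic, H1.smul, norm_mul, Complex.norm_real, Real.norm_eq_abs, mul_pow, sq_abs, h4]
  rw [mul_left_comm]
  congr 1
  rw [← integral_const_mul]
  congr 1; ext r; ring

theorem infEnergy_lt_of_defect_mul_mass_lt {ν lp lm l0 ρ : ℝ} (hρ : 0 < ρ) (p q : H1)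
    (hM : 0 < mass p q) (h : defect ν p q * mass p q < 4 * quartic lp lm l0 p q * ρ) :
    infEnergy ν lp lm l0 ρ < infEnergyLin ν ρ := by
  refine lt_of_lt_of_le ?_ (le_infEnergyLin ν ρ)
  set t := Real.sqrt (ρ / mass p q)
  have ht : t ^ 2 = ρ / mass p q := Real.sq_sqrt (by positivity)
  have ht4 : t ^ 4 = (ρ / mass p q) ^ 2 := by rw [← ht]; ring
  have hmass : mass (p.smul t) (q.smul t) = ρ := by
    rw [mass_smul, ht, div_mul_cancel₀ _ hM.ne']
  refine lt_of_le_of_lt (sInf_le ⟨p.smul t, q.smul t, hmass, rfl⟩) ?_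
  have e : energy ν lp lm l0 (p.smul t) (q.smul t)
      = energyLin ν (p.smul t) (q.smul t) - quartic lp lm l0 (p.smul t) (q.smul t) := rfl
  rw [EReal.coe_lt_coe_iff, e, energyLin_eq, hmass, defect_smul, quartic_smul, ht, ht4]
  have := scaled_energy_neg hM hρ h
  linarith

/-! ### Smooth compactly supported elements of `H¹(ℝ²)` -/

theorem isWeakPartial_of_hasLineDerivAt {e : ℝ × ℝ} {u g : ℝ × ℝ → ℂ} (hu : Continuous u)
    (hg : Continuous g) (h : ∀ z, HasLineDerivAt ℝ u (g z) z e) : IsWeakPartial e u g := by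
  intro φ hφ hc
  have hdφ : Continuous fun z => fderiv ℝ φ z e :=
    (hφ.continuous_fderiv (by simp)).clm_apply continuous_const
  have hdc : HasCompactSupport fun z => fderiv ℝ φ z e := hc.fderiv_apply (𝕜 := ℝ) e
  have := integral_bilinear_hasLineDerivAt_right_eq_neg_left_of_integrable (μ := volume)
    (f := φ) (f' := fun z => fderiv ℝ φ z e) (g := u) (g' := g) (v := e)
    (B := ContinuousLinearMap.lsmul ℝ ℝ)
    ((hdφ.smul hu).integrable_of_hasCompactSupport hdc.smul_right)
    ((hφ.continuous.smul hg).integrable_of_hasCompactSupport hc.smul_right)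
    ((hφ.continuous.smul hu).integrable_of_hasCompactSupport hc.smul_right)
    (fun z _ => (hφ.differentiable (by simp) z).hasFDerivAt.hasLineDerivAt e) (fun z _ => h z)
  simp only [ContinuousLinearMap.lsmul_apply] at this
  rw [this, neg_neg]

/-- A `C¹` function with compact support as an element of `H¹(ℝ²)`. -/
def H1.ofHasLineDerivAt (u ux uy : ℝ × ℝ → ℂ) (hu : Continuous u) (hux : Continuous ux)
    (huy : Continuous uy) (hc : HasCompactSupport u) (hcx : HasCompactSupport ux)
    (hcy : HasCompactSupport uy) (hx : ∀ z, HasLineDerivAt ℝ u (ux z) z (1, 0))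
    (hy : ∀ z, HasLineDerivAt ℝ u (uy z) z (0, 1)) : H1 where
  toFun := u
  dx := ux
  dy := uy
  memLp_toFun := hu.memLp_of_hasCompactSupport hc
  memLp_dx := hux.memLp_of_hasCompactSupport hcx
  memLp_dy := huy.memLp_of_hasCompactSupport hcy
  isWeakPartial_dx := isWeakPartial_of_hasLineDerivAt hu hux hx
  isWeakPartial_dy := isWeakPartial_of_hasLineDerivAt hu huy hy

theorem hasLineDerivAt_tensor_fst {g h : ℝ → ℂ} {g' : ℂ} (z : ℝ × ℝ)
    (hg : HasDerivAt g g' z.1) :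
    HasLineDerivAt ℝ (fun z : ℝ × ℝ => g z.1 * h z.2) (g' * h z.2) z (1, 0) := by
  have h1 : HasDerivAt (fun t : ℝ => g (z.1 + t)) g' 0 := by
    refine HasDerivAt.comp_const_add z.1 0 ?_
    simpa using hg
  simpa [HasLineDerivAt] using h1.mul_const (h z.2)

theorem hasLineDerivAt_tensor_snd {g h : ℝ → ℂ} {h' : ℂ} (z : ℝ × ℝ)
    (hh : HasDerivAt h h' z.2) :
    HasLineDerivAt ℝ (fun z : ℝ × ℝ => g z.1 * h z.2) (g z.1 * h') z (0, 1) := by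
  have h1 : HasDerivAt (fun t : ℝ => h (z.2 + t)) h' 0 := by
    refine HasDerivAt.comp_const_add z.2 0 ?_
    simpa using hh
  simpa [HasLineDerivAt] using h1.const_mul (g z.1)

/-- The box `[-a, a] × [-b, b]`. -/
def box (a b : ℝ) : Set (ℝ × ℝ) := Icc (-a) a ×ˢ Icc (-b) b

theorem isCompact_box (a b : ℝ) : IsCompact (box a b) := isCompact_Icc.prod isCompact_Icc

theorem volume_real_box {a b : ℝ} (ha : 0 ≤ a) (hb : 0 ≤ b) :
    volume.real (box a b) = 4 * a * b := by
  rw [box, Measure.volume_eq_prod, measureReal_prod_prod, Real.volume_real_Icc_of_le (by linarith),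
    Real.volume_real_Icc_of_le (by linarith)]
  ring

theorem integral_le_of_box {h : ℝ × ℝ → ℝ} {a b K : ℝ} (ha : 0 ≤ a) (hb : 0 ≤ b)
    (h0 : ∀ z, 0 ≤ h z) (hz : ∀ z, z ∉ box a b → h z = 0) (hK : ∀ z, h z ≤ K) :
    ∫ z, h z ≤ K * (4 * a * b) := by
  have hi : Integrable ((box a b).indicator fun _ => K) :=
    (integrable_indicator_iff (isCompact_box a b).measurableSet).2
      (integrableOn_const (isCompact_box a b).measure_lt_top.ne)
  calc ∫ z, h z ≤ ∫ z, (box a b).indicator (fun _ => K) z := by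
        refine integral_mono_of_nonneg (Eventually.of_forall h0) hi
          (Eventually.of_forall fun z => ?_)
        by_cases hzm : z ∈ box a b
        · simpa [indicator_of_mem hzm] using hK z
        · simp [indicator_of_notMem hzm, hz z hzm]
    _ = K * (4 * a * b) := by
        rw [integral_indicator (isCompact_box a b).measurableSet, setIntegral_const,
          volume_real_box ha hb, smul_eq_mul, mul_comm]

theorem le_integral_of_box {h : ℝ × ℝ → ℝ} {a b k : ℝ} (ha : 0 ≤ a) (hb : 0 ≤ b)
    (hi : Integrable h) (h0 : ∀ z, 0 ≤ h z) (hk : ∀ z ∈ box a b, k ≤ h z) :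
    k * (4 * a * b) ≤ ∫ z, h z := by
  calc k * (4 * a * b) = ∫ _ in box a b, k := by
        rw [setIntegral_const, volume_real_box ha hb, smul_eq_mul, mul_comm]
    _ ≤ ∫ z in box a b, h z :=
        setIntegral_mono_on (integrableOn_const (isCompact_box a b).measure_lt_top.ne)
          hi.integrableOn (isCompact_box a b).measurableSet hk
    _ ≤ ∫ z, h z := setIntegral_le_integral hi (Eventually.of_forall h0)

/-! ### Modulated wave packets -/

/-- `η` is a cutoff at scale `R`, with first and second derivatives `η₁` and `η₂` of order
`B / R` and `B / R ^ 2`. -/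
structure IsCutoff (B R : ℝ) (η η₁ η₂ : ℝ → ℝ) : Prop where
  hasDerivAt : ∀ x, HasDerivAt η (η₁ x) x
  hasDerivAt_deriv : ∀ x, HasDerivAt η₁ (η₂ x) x
  continuous_deriv_deriv : Continuous η₂
  abs_le_one : ∀ x, |η x| ≤ 1
  eq_one : ∀ x, |x| ≤ R → η x = 1
  abs_deriv_le : ∀ x, |η₁ x| ≤ B / R
  abs_deriv_deriv_le : ∀ x, |η₂ x| ≤ B / R ^ 2
  eq_zero : ∀ x, 2 * R < |x| → η x = 0 ∧ η₁ x = 0 ∧ η₂ x = 0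

theorem exists_isCutoff : ∃ B : ℝ, 0 < B ∧ ∀ R : ℝ, 0 < R → ∃ η η₁ η₂, IsCutoff B R η η₁ η₂ := by
  obtain ⟨χ, B, hB, hχ, hχ0, hχ1, hχone, hχzero, hχB, hχc⟩ := exists_cutoff
  have hχ' : ContDiff ℝ (⊤ : ℕ∞) (deriv χ) := (contDiff_infty_iff_deriv.1 hχ).2
  have hχ'' : Continuous (deriv (deriv χ)) := hχ'.continuous_deriv (by simp)
  obtain ⟨B₂, hB₂⟩ := hχ''.bounded_above_of_compact_support hχc.deriv.deriv
  have hd : ∀ x, HasDerivAt χ (deriv χ x) x := fun x => (hχ.differentiable (by simp) x).hasDerivAt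
  have hd' : ∀ x, HasDerivAt (deriv χ) (deriv (deriv χ) x) x := fun x =>
    (hχ'.differentiable (by simp) x).hasDerivAt
  have hz : ∀ x, 2 < |x| → χ =ᶠ[𝓝 x] fun _ => 0 := fun x hx => by
    filter_upwards [continuous_abs.continuousAt.eventually (lt_mem_nhds hx)] with y hy
      using hχzero y (le_of_lt hy)
  refine ⟨max B B₂, lt_max_of_lt_left hB, fun R hR => ⟨fun x => χ (x / R),
    fun x => deriv χ (x / R) / R, fun x => deriv (deriv χ) (x / R) / R ^ 2, ?_⟩⟩
  refine ⟨fun x => ?_, fun x => ?_, (hχ''.comp (continuous_id.div_const R)).div_const _,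
    fun x => ?_, fun x hx => ?_, fun x => ?_, fun x => ?_, fun x hx => ?_⟩
  · exact ((hd (x / R)).comp x ((hasDerivAt_id x).div_const R)).congr_deriv (by ring)
  · have h := ((hd' (x / R)).comp x ((hasDerivAt_id x).div_const R)).div_const R
    refine HasDerivAt.congr_deriv (f := fun x => deriv χ (x / R) / R) h ?_
    ring
  · rw [abs_of_nonneg (hχ0 _)]; exact hχ1 _
  · exact hχone _ (by rw [abs_div, abs_of_pos hR]; exact (div_le_one hR).2 hx)
  · rw [abs_div, abs_of_pos hR]
    exact div_le_div_of_nonneg_right ((hχB _).trans (le_max_left _ _)) hR.le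
  · rw [abs_div, abs_of_pos (pow_pos hR 2)]
    exact div_le_div_of_nonneg_right ((hB₂ _).trans (le_max_right _ _)) (pow_pos hR 2).le
  · have h := hz (x / R) (by rw [abs_div, abs_of_pos hR, lt_div_iff₀ hR]; exact hx)
    have h' : deriv χ =ᶠ[𝓝 (x / R)] fun _ => 0 := by simpa using h.deriv
    refine ⟨h.eq_of_nhds, ?_, ?_⟩
    · simp [h'.eq_of_nhds]
    · simp [h'.deriv_eq]

/-- The plane wave `e^{i ν x}`. -/
noncomputable def planeWave (ν x : ℝ) : ℂ := Complex.exp (((ν * x : ℝ) : ℂ) * Complex.I)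

theorem norm_planeWave (ν x : ℝ) : ‖planeWave ν x‖ = 1 := Complex.norm_exp_ofReal_mul_I _

theorem hasDerivAt_planeWave (ν x : ℝ) :
    HasDerivAt (planeWave ν) (planeWave ν x * (Complex.I * ν)) x := by
  have h1 : HasDerivAt (fun x : ℝ => ((ν * x : ℝ) : ℂ) * Complex.I) (ν * Complex.I) x := by
    have := (((hasDerivAt_id x).const_mul ν).ofReal_comp).mul_const Complex.I
    simpa using this
  refine h1.cexp.congr_deriv ?_
  rw [planeWave]; ring

theorem hasDerivAt_planeWave_mul {ν x : ℝ} {η : ℝ → ℂ} {η' : ℂ} (h : HasDerivAt η η' x) :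
    HasDerivAt (fun x => planeWave ν x * η x)
      (planeWave ν x * (Complex.I * ν * η x + η')) x := by
  refine ((hasDerivAt_planeWave ν x).mul h).congr_deriv ?_
  ring

section WavePacket

variable {ν B R S : ℝ} {η η₁ η₂ θ θ₁ θ₂ : ℝ → ℝ}

theorem IsCutoff.continuous (h : IsCutoff B R η η₁ η₂) : Continuous η :=
  continuous_iff_continuousAt.2 fun x => (h.hasDerivAt x).continuousAt

theorem IsCutoff.continuous_deriv (h : IsCutoff B R η η₁ η₂) : Continuous η₁ :=
  continuous_iff_continuousAt.2 fun x => (h.hasDerivAt_deriv x).continuousAt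

theorem continuous_planeWave (ν : ℝ) : Continuous (planeWave ν) :=
  continuous_iff_continuousAt.2 fun x => (hasDerivAt_planeWave ν x).continuousAt

/-- The modulated cutoff `e^{iνx} η(x)`. -/
noncomputable def wave (ν : ℝ) (η : ℝ → ℝ) (x : ℝ) : ℂ := planeWave ν x * η x

/-- The derivative of `wave`. -/
noncomputable def waveDeriv (ν : ℝ) (η η₁ : ℝ → ℝ) (x : ℝ) : ℂ :=
  planeWave ν x * (Complex.I * ν * η x + η₁ x)

/-- The second derivative of `wave`. -/
noncomputable def waveDerivDeriv (ν : ℝ) (η η₁ η₂ : ℝ → ℝ) (x : ℝ) : ℂ :=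
  planeWave ν x * (Complex.I * ν * (Complex.I * ν * η x + η₁ x) + (Complex.I * ν * η₁ x + η₂ x))

theorem IsCutoff.hasDerivAt_wave (h : IsCutoff B R η η₁ η₂) (ν x : ℝ) :
    HasDerivAt (wave ν η) (waveDeriv ν η η₁ x) x :=
  hasDerivAt_planeWave_mul (h.hasDerivAt x).ofReal_comp

theorem IsCutoff.hasDerivAt_waveDeriv (h : IsCutoff B R η η₁ η₂) (ν x : ℝ) :
    HasDerivAt (waveDeriv ν η η₁) (waveDerivDeriv ν η η₁ η₂ x) x :=
  hasDerivAt_planeWave_mul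
    ((((h.hasDerivAt x).ofReal_comp).const_mul _).add (h.hasDerivAt_deriv x).ofReal_comp)

theorem IsCutoff.continuous_wave (h : IsCutoff B R η η₁ η₂) (ν : ℝ) : Continuous (wave ν η) :=
  continuous_iff_continuousAt.2 fun x => (h.hasDerivAt_wave ν x).continuousAt

theorem IsCutoff.continuous_waveDeriv (h : IsCutoff B R η η₁ η₂) (ν : ℝ) :
    Continuous (waveDeriv ν η η₁) :=
  continuous_iff_continuousAt.2 fun x => (h.hasDerivAt_waveDeriv ν x).continuousAt

theorem IsCutoff.continuous_waveDerivDeriv (h : IsCutoff B R η η₁ η₂) (ν : ℝ) :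
    Continuous (waveDerivDeriv ν η η₁ η₂) := by
  have h0 := h.continuous
  have h1 := h.continuous_deriv
  have h2 := h.continuous_deriv_deriv
  have h3 := continuous_planeWave ν
  unfold waveDerivDeriv
  fun_prop

theorem IsCutoff.wave_eq_zero (h : IsCutoff B R η η₁ η₂) (ν : ℝ) {x : ℝ} (hx : 2 * R < |x|) :
    wave ν η x = 0 ∧ waveDeriv ν η η₁ x = 0 ∧ waveDerivDeriv ν η η₁ η₂ x = 0 := by
  obtain ⟨h0, h1, h2⟩ := h.eq_zero x hx
  simp [wave, waveDeriv, waveDerivDeriv, h0, h1, h2]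

theorem IsCutoff.norm_wave_le (h : IsCutoff B R η η₁ η₂) (ν x : ℝ) : ‖wave ν η x‖ ≤ 1 := by
  rw [wave, norm_mul, norm_planeWave, one_mul, Complex.norm_real]
  exact h.abs_le_one x

theorem IsCutoff.norm_waveDeriv_le (h : IsCutoff B R η η₁ η₂) (hν : 0 ≤ ν) (x : ℝ) :
    ‖waveDeriv ν η η₁ x‖ ≤ ν + B / R := by
  rw [waveDeriv, norm_mul, norm_planeWave, one_mul]
  refine (norm_add_le _ _).trans (add_le_add ?_ ?_)
  · rw [norm_mul, norm_mul, Complex.norm_I, one_mul, Complex.norm_real, Complex.norm_real,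
      Real.norm_eq_abs, Real.norm_eq_abs, abs_of_nonneg hν]
    exact mul_le_of_le_one_right hν (h.abs_le_one x)
  · rw [Complex.norm_real]; exact h.abs_deriv_le x

/-- The plane wave is annihilated by `∂ₓ² + ν²`, so only `2iν η'` and `η''` remain next to it. -/
theorem IsCutoff.norm_waveDerivDeriv_add_le (h : IsCutoff B R η η₁ η₂) (hν : 0 ≤ ν) (x : ℝ) :
    ‖waveDerivDeriv ν η η₁ η₂ x + ν ^ 2 * wave ν η x‖ ≤ 2 * ν * (B / R) + B / R ^ 2 := by
  have e : waveDerivDeriv ν η η₁ η₂ x + ν ^ 2 * wave ν η x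
      = planeWave ν x * (2 * Complex.I * ν * η₁ x + η₂ x) := by
    rw [waveDerivDeriv, wave]
    linear_combination (planeWave ν x * ν ^ 2 * η x) * Complex.I_sq
  rw [e, norm_mul, norm_planeWave, one_mul]
  refine (norm_add_le _ _).trans (add_le_add ?_ ?_)
  · rw [norm_mul, norm_mul, norm_mul, Complex.norm_I, Complex.norm_real, Complex.norm_real,
      Real.norm_eq_abs, Real.norm_eq_abs, abs_of_nonneg hν]
    simp only [Complex.norm_ofNat, mul_one]
    exact mul_le_mul_of_nonneg_left (h.abs_deriv_le x) (by positivity)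
  · rw [Complex.norm_real]; exact h.abs_deriv_deriv_le x

theorem hasCompactSupport_of_box {E : Type*} [Zero E] {u : ℝ × ℝ → E} {a b : ℝ}
    (h : ∀ z, z ∉ box a b → u z = 0) : HasCompactSupport u :=
  HasCompactSupport.intro (isCompact_box a b) h

theorem lt_abs_of_notMem_box {a b : ℝ} {z : ℝ × ℝ} (hz : z ∉ box a b) :
    a < |z.1| ∨ b < |z.2| := by
  by_contra h
  rw [not_or, not_lt, not_lt] at h
  exact hz ⟨abs_le.1 h.1, abs_le.1 h.2⟩

/-- The first component `e^{iνx} η(x) θ(y)` of a wave packet. -/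
noncomputable def wavePacket (ν : ℝ) (hη : IsCutoff B R η η₁ η₂) (hθ : IsCutoff B S θ θ₁ θ₂) :
    H1 :=
  have hz : ∀ {f g : ℝ → ℂ}, (∀ x, 2 * R < |x| → f x = 0) → (∀ y, 2 * S < |y| → g y = 0) →
      HasCompactSupport fun z : ℝ × ℝ => f z.1 * g z.2 := fun hf hg =>
    hasCompactSupport_of_box (a := 2 * R) (b := 2 * S) fun z hz => by
      rcases lt_abs_of_notMem_box hz with h | h
      · rw [hf _ h, zero_mul]
      · rw [hg _ h, mul_zero]
  H1.ofHasLineDerivAt (fun z => wave ν η z.1 * θ z.2) (fun z => waveDeriv ν η η₁ z.1 * θ z.2)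
    (fun z => wave ν η z.1 * θ₁ z.2)
    (((hη.continuous_wave ν).comp continuous_fst).mul
      (Complex.continuous_ofReal.comp (hθ.continuous.comp continuous_snd)))
    (((hη.continuous_waveDeriv ν).comp continuous_fst).mul
      (Complex.continuous_ofReal.comp (hθ.continuous.comp continuous_snd)))
    (((hη.continuous_wave ν).comp continuous_fst).mul
      (Complex.continuous_ofReal.comp (hθ.continuous_deriv.comp continuous_snd)))
    (hz (g := fun y => (θ y : ℂ)) (fun x hx => (hη.wave_eq_zero ν hx).1)
      fun y hy => by simp [(hθ.eq_zero y hy).1])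
    (hz (g := fun y => (θ y : ℂ)) (fun x hx => (hη.wave_eq_zero ν hx).2.1)
      fun y hy => by simp [(hθ.eq_zero y hy).1])
    (hz (g := fun y => (θ₁ y : ℂ)) (fun x hx => (hη.wave_eq_zero ν hx).1)
      fun y hy => by simp [(hθ.eq_zero y hy).2.1])
    (fun z => hasLineDerivAt_tensor_fst (h := fun y => (θ y : ℂ)) z (hη.hasDerivAt_wave ν z.1))
    (fun z => hasLineDerivAt_tensor_snd (h := fun y => (θ y : ℂ)) z
      (hθ.hasDerivAt z.2).ofReal_comp)

theorem hasLineDerivAt_combination {u v : ℝ × ℝ → ℂ} {u' v' : ℂ} {z e : ℝ × ℝ}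
    (hu : HasLineDerivAt ℝ u u' z e) (hv : HasLineDerivAt ℝ v v' z e) (c : ℂ) :
    HasLineDerivAt ℝ (fun z => c * (u z + Complex.I * v z)) (c * (u' + Complex.I * v')) z e :=
  (HasDerivAt.add hu (HasDerivAt.const_mul Complex.I hv)).const_mul c

/-- The second component `D⁺ u / ν`, where `u` is the first. -/
noncomputable def wavePacketSnd (ν : ℝ) (hη : IsCutoff B R η η₁ η₂)
    (hθ : IsCutoff B S θ θ₁ θ₂) : H1 :=
  have hz : ∀ {f f' g g' : ℝ → ℂ}, (∀ x, 2 * R < |x| → f x = 0) → (∀ x, 2 * R < |x| → f' x = 0) →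
      (∀ y, 2 * S < |y| → g y = 0) → (∀ y, 2 * S < |y| → g' y = 0) → HasCompactSupport
        fun z : ℝ × ℝ => (ν : ℂ)⁻¹ * (f z.1 * g z.2 + Complex.I * (f' z.1 * g' z.2)) :=
    fun hf hf' hg hg' => hasCompactSupport_of_box (a := 2 * R) (b := 2 * S) fun z hz => by
      rcases lt_abs_of_notMem_box hz with h | h
      · rw [hf _ h, hf' _ h]; simp
      · rw [hg _ h, hg' _ h]; simp
  have c0 := (hη.continuous_wave ν).comp (continuous_fst (X := ℝ) (Y := ℝ))
  have c1 := (hη.continuous_waveDeriv ν).comp (continuous_fst (X := ℝ) (Y := ℝ))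
  have c2 := (hη.continuous_waveDerivDeriv ν).comp (continuous_fst (X := ℝ) (Y := ℝ))
  have d0 := Complex.continuous_ofReal.comp
    (hθ.continuous.comp (continuous_snd (X := ℝ) (Y := ℝ)))
  have d1 := Complex.continuous_ofReal.comp
    (hθ.continuous_deriv.comp (continuous_snd (X := ℝ) (Y := ℝ)))
  have d2 := Complex.continuous_ofReal.comp
    (hθ.continuous_deriv_deriv.comp (continuous_snd (X := ℝ) (Y := ℝ)))
  have z0 : ∀ y, 2 * S < |y| → (θ y : ℂ) = 0 := fun y hy => by simp [(hθ.eq_zero y hy).1]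
  have z1 : ∀ y, 2 * S < |y| → (θ₁ y : ℂ) = 0 := fun y hy => by simp [(hθ.eq_zero y hy).2.1]
  have z2 : ∀ y, 2 * S < |y| → (θ₂ y : ℂ) = 0 := fun y hy => by simp [(hθ.eq_zero y hy).2.2]
  H1.ofHasLineDerivAt
    (fun z => (ν : ℂ)⁻¹ * (waveDeriv ν η η₁ z.1 * θ z.2 + Complex.I * (wave ν η z.1 * θ₁ z.2)))
    (fun z => (ν : ℂ)⁻¹ * (waveDerivDeriv ν η η₁ η₂ z.1 * θ z.2
      + Complex.I * (waveDeriv ν η η₁ z.1 * θ₁ z.2)))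
    (fun z => (ν : ℂ)⁻¹ * (waveDeriv ν η η₁ z.1 * θ₁ z.2 + Complex.I * (wave ν η z.1 * θ₂ z.2)))
    (continuous_const.mul ((c1.mul d0).add (continuous_const.mul (c0.mul d1))))
    (continuous_const.mul ((c2.mul d0).add (continuous_const.mul (c1.mul d1))))
    (continuous_const.mul ((c1.mul d1).add (continuous_const.mul (c0.mul d2))))
    (hz (f := waveDeriv ν η η₁) (f' := wave ν η) (g := fun y => (θ y : ℂ))
      (g' := fun y => (θ₁ y : ℂ)) (fun x hx => (hη.wave_eq_zero ν hx).2.1)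
      (fun x hx => (hη.wave_eq_zero ν hx).1) z0 z1)
    (hz (f := waveDerivDeriv ν η η₁ η₂) (f' := waveDeriv ν η η₁) (g := fun y => (θ y : ℂ))
      (g' := fun y => (θ₁ y : ℂ)) (fun x hx => (hη.wave_eq_zero ν hx).2.2)
      (fun x hx => (hη.wave_eq_zero ν hx).2.1) z0 z1)
    (hz (f := waveDeriv ν η η₁) (f' := wave ν η) (g := fun y => (θ₁ y : ℂ))
      (g' := fun y => (θ₂ y : ℂ)) (fun x hx => (hη.wave_eq_zero ν hx).2.1)
      (fun x hx => (hη.wave_eq_zero ν hx).1) z1 z2)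
    (fun z => hasLineDerivAt_combination
      (hasLineDerivAt_tensor_fst (h := fun y => (θ y : ℂ)) z (hη.hasDerivAt_waveDeriv ν z.1))
      (hasLineDerivAt_tensor_fst (h := fun y => (θ₁ y : ℂ)) z (hη.hasDerivAt_wave ν z.1)) _)
    (fun z => hasLineDerivAt_combination
      (hasLineDerivAt_tensor_snd (h := fun y => (θ y : ℂ)) z (hθ.hasDerivAt z.2).ofReal_comp)
      (hasLineDerivAt_tensor_snd (h := fun y => (θ₁ y : ℂ)) z
        (hθ.hasDerivAt_deriv z.2).ofReal_comp) _)

theorem Dplus_wavePacket_sub (hν : ν ≠ 0) (hη : IsCutoff B R η η₁ η₂)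
    (hθ : IsCutoff B S θ θ₁ θ₂) (z : ℝ × ℝ) :
    (wavePacket ν hη hθ).Dplus z - ν * wavePacketSnd ν hη hθ z = 0 := by
  have : (ν : ℂ) ≠ 0 := by exact_mod_cast hν
  simp only [H1.Dplus, wavePacket, wavePacketSnd, H1.ofHasLineDerivAt]
  field_simp
  ring

/-- As `D⁻D⁺ = Δ`, the defect is `(Δu + ν²u)/ν` for the first component `u`. The mixed derivatives
cancel, so the transverse cutoff enters only through `θ` and `θ₂`; this is why `S` may be much
smaller than `R`. -/
theorem Dminus_wavePacketSnd_add (hν : ν ≠ 0) (hη : IsCutoff B R η η₁ η₂)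
    (hθ : IsCutoff B S θ θ₁ θ₂) (z : ℝ × ℝ) :
    (wavePacketSnd ν hη hθ).Dminus z + ν * wavePacket ν hη hθ z
      = (ν : ℂ)⁻¹ * ((waveDerivDeriv ν η η₁ η₂ z.1 + ν ^ 2 * wave ν η z.1) * θ z.2
        + wave ν η z.1 * θ₂ z.2) := by
  have : (ν : ℂ) ≠ 0 := by exact_mod_cast hν
  simp only [H1.Dminus, wavePacket, wavePacketSnd, H1.ofHasLineDerivAt]
  field_simp
  linear_combination (-(wave ν η z.1 * θ₂ z.2)) * Complex.I_sq

end WavePacket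

/-! ### Mass, defect and quartic term of a wave packet -/

section WavePacketEstimates

variable {ν B R S : ℝ} {η η₁ η₂ θ θ₁ θ₂ : ℝ → ℝ}

theorem wavePacket_eq_zero (hη : IsCutoff B R η η₁ η₂) (hθ : IsCutoff B S θ θ₁ θ₂) {z : ℝ × ℝ}
    (hz : z ∉ box (2 * R) (2 * S)) : wavePacket ν hη hθ z = 0 ∧ wavePacketSnd ν hη hθ z = 0 ∧
      (wavePacketSnd ν hη hθ).Dminus z = 0 := by
  simp only [H1.Dminus, wavePacket, wavePacketSnd, H1.ofHasLineDerivAt]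
  rcases lt_abs_of_notMem_box hz with h | h
  · obtain ⟨h0, h1, h2⟩ := hη.wave_eq_zero ν h
    simp [h0, h1, h2]
  · obtain ⟨h0, h1, h2⟩ := hθ.eq_zero _ h
    simp [h0, h1, h2]

theorem norm_wavePacket_le (hη : IsCutoff B R η η₁ η₂) (hθ : IsCutoff B S θ θ₁ θ₂) (z : ℝ × ℝ) :
    ‖wavePacket ν hη hθ z‖ ≤ 1 := by
  change ‖wave ν η z.1 * θ z.2‖ ≤ 1
  rw [norm_mul, Complex.norm_real]
  exact mul_le_one₀ (hη.norm_wave_le ν _) (norm_nonneg _) (hθ.abs_le_one _)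

theorem norm_wavePacket_eq_one (hη : IsCutoff B R η η₁ η₂) (hθ : IsCutoff B S θ θ₁ θ₂)
    {z : ℝ × ℝ} (hz : z ∈ box R S) : ‖wavePacket ν hη hθ z‖ = 1 := by
  change ‖wave ν η z.1 * θ z.2‖ = 1
  rw [wave, hη.eq_one _ (abs_le.2 hz.1), hθ.eq_one _ (abs_le.2 hz.2)]
  simp [norm_planeWave]

theorem norm_wavePacketSnd_le (hν : 0 < ν) (hη : IsCutoff B R η η₁ η₂)
    (hθ : IsCutoff B S θ θ₁ θ₂) (z : ℝ × ℝ) :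
    ‖wavePacketSnd ν hη hθ z‖ ≤ ν⁻¹ * (ν + B / R + B / S) := by
  change ‖(ν : ℂ)⁻¹ * (waveDeriv ν η η₁ z.1 * θ z.2 + Complex.I * (wave ν η z.1 * θ₁ z.2))‖ ≤ _
  rw [norm_mul, norm_inv, Complex.norm_real, Real.norm_eq_abs, abs_of_pos hν]
  refine mul_le_mul_of_nonneg_left ((norm_add_le _ _).trans (add_le_add ?_ ?_))
    (inv_pos.2 hν).le
  · rw [norm_mul, Complex.norm_real]
    exact (mul_le_of_le_one_right (norm_nonneg _) (hθ.abs_le_one _)).trans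
      (hη.norm_waveDeriv_le hν.le _)
  · rw [norm_mul, norm_mul, Complex.norm_I, one_mul, Complex.norm_real]
    exact (mul_le_of_le_one_left (norm_nonneg _) (hη.norm_wave_le ν _)).trans
      (hθ.abs_deriv_le _)

theorem norm_Dminus_wavePacketSnd_add_le (hν : 0 < ν) (hη : IsCutoff B R η η₁ η₂)
    (hθ : IsCutoff B S θ θ₁ θ₂) (z : ℝ × ℝ) :
    ‖(wavePacketSnd ν hη hθ).Dminus z + ν * wavePacket ν hη hθ z‖
      ≤ ν⁻¹ * (2 * ν * (B / R) + B / R ^ 2 + B / S ^ 2) := by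
  rw [Dminus_wavePacketSnd_add hν.ne', norm_mul, norm_inv, Complex.norm_real, Real.norm_eq_abs,
    abs_of_pos hν]
  refine mul_le_mul_of_nonneg_left ((norm_add_le _ _).trans (add_le_add ?_ ?_))
    (inv_pos.2 hν).le
  · rw [norm_mul, Complex.norm_real]
    exact (mul_le_of_le_one_right (norm_nonneg _) (hθ.abs_le_one _)).trans
      (hη.norm_waveDerivDeriv_add_le hν.le _)
  · rw [norm_mul, Complex.norm_real]
    exact (mul_le_of_le_one_left (norm_nonneg _) (hη.norm_wave_le ν _)).trans
      (hθ.abs_deriv_deriv_le _)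

theorem continuous_wavePacket (hη : IsCutoff B R η η₁ η₂) (hθ : IsCutoff B S θ θ₁ θ₂) :
    Continuous (wavePacket ν hη hθ).toFun :=
  ((hη.continuous_wave ν).comp continuous_fst).mul
    (Complex.continuous_ofReal.comp (hθ.continuous.comp continuous_snd))

theorem continuous_wavePacketSnd (hη : IsCutoff B R η η₁ η₂) (hθ : IsCutoff B S θ θ₁ θ₂) :
    Continuous (wavePacketSnd ν hη hθ).toFun :=
  continuous_const.mul ((((hη.continuous_waveDeriv ν).comp continuous_fst).mul
    (Complex.continuous_ofReal.comp (hθ.continuous.comp continuous_snd))).add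
    (continuous_const.mul (((hη.continuous_wave ν).comp continuous_fst).mul
    (Complex.continuous_ofReal.comp (hθ.continuous_deriv.comp continuous_snd)))))

theorem mass_wavePacket_le (hν : 0 < ν) (hR : 0 < R) (hS : 0 < S) (hη : IsCutoff B R η η₁ η₂)
    (hθ : IsCutoff B S θ θ₁ θ₂) :
    mass (wavePacket ν hη hθ) (wavePacketSnd ν hη hθ)
      ≤ (1 + (ν⁻¹ * (ν + B / R + B / S)) ^ 2) * (16 * R * S) := by
  rw [mass_eq]
  refine (integral_le_of_box (a := 2 * R) (b := 2 * S)
    (K := 1 + (ν⁻¹ * (ν + B / R + B / S)) ^ 2) (by linarith) (by linarith)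
    (fun z => by positivity) (fun z hz => ?_) (fun z => add_le_add ?_ ?_)).trans
    (le_of_eq (by ring))
  · obtain ⟨h0, h1, -⟩ := wavePacket_eq_zero (ν := ν) hη hθ hz
    rw [h0, h1]; simp
  · exact pow_le_one₀ (norm_nonneg _) (norm_wavePacket_le hη hθ z)
  · exact pow_le_pow_left₀ (norm_nonneg _) (norm_wavePacketSnd_le hν hη hθ z) 2

theorem mass_wavePacket_pos (hR : 0 < R) (hS : 0 < S) (hη : IsCutoff B R η η₁ η₂)
    (hθ : IsCutoff B S θ θ₁ θ₂) :
    0 < mass (wavePacket ν hη hθ) (wavePacketSnd ν hη hθ) := by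
  have h := le_integral_of_box (k := 1) hR.le hS.le
    ((wavePacket ν hη hθ).memLp_toFun.integrable_norm_pow (by norm_num))
    (fun z => by positivity)
    (fun z hz => by rw [norm_wavePacket_eq_one hη hθ hz, one_pow])
  have h2 : 0 ≤ ∫ z, ‖wavePacketSnd ν hη hθ z‖ ^ 2 := integral_nonneg fun z => by positivity
  have h3 : 0 < 4 * R * S := by positivity
  rw [mass]
  linarith

theorem defect_wavePacket_le (hν : 0 < ν) (hR : 0 < R) (hS : 0 < S) (hη : IsCutoff B R η η₁ η₂)
    (hθ : IsCutoff B S θ θ₁ θ₂) :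
    defect ν (wavePacket ν hη hθ) (wavePacketSnd ν hη hθ)
      ≤ (ν⁻¹ * (2 * ν * (B / R) + B / R ^ 2 + B / S ^ 2)) ^ 2 * (16 * R * S) := by
  simp only [defect, Dplus_wavePacket_sub hν.ne']
  simp only [norm_zero, ne_eq, OfNat.ofNat_ne_zero, not_false_eq_true, zero_pow, add_zero]
  refine (integral_le_of_box (a := 2 * R) (b := 2 * S)
    (K := (ν⁻¹ * (2 * ν * (B / R) + B / R ^ 2 + B / S ^ 2)) ^ 2) (by linarith) (by linarith)
    (fun z => by positivity) (fun z hz => ?_) (fun z => ?_)).trans (le_of_eq (by ring))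
  · obtain ⟨h0, -, h2⟩ := wavePacket_eq_zero (ν := ν) hη hθ hz
    rw [h0, h2]; simp
  · exact pow_le_pow_left₀ (norm_nonneg _) (norm_Dminus_wavePacketSnd_add_le hν hη hθ z) 2

/-- The `λ₊` term on the inner box, where the first component has modulus one, is enough; the other
terms are nonnegative. -/
theorem le_quartic_wavePacket (hR : 0 < R) (hS : 0 < S) (hη : IsCutoff B R η η₁ η₂)
    (hθ : IsCutoff B S θ θ₁ θ₂) {lp lm l0 : ℝ} (hlp : 0 < lp) (hlm : 0 < lm) (hl0 : 0 < l0) :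
    lp * (4 * R * S) ≤ 4 * quartic lp lm l0 (wavePacket ν hη hθ) (wavePacketSnd ν hη hθ) := by
  have hp := continuous_wavePacket (ν := ν) hη hθ
  have hq := continuous_wavePacketSnd (ν := ν) hη hθ
  have hi : Integrable fun z => lp * ‖wavePacket ν hη hθ z‖ ^ 4
      + lm * ‖wavePacketSnd ν hη hθ z‖ ^ 4
      + 2 * l0 * ‖wavePacket ν hη hθ z‖ ^ 2 * ‖wavePacketSnd ν hη hθ z‖ ^ 2 := by
    refine Continuous.integrable_of_hasCompactSupport (by fun_prop)
      (hasCompactSupport_of_box (a := 2 * R) (b := 2 * S) fun z hz => ?_)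
    obtain ⟨h0, h1, -⟩ := wavePacket_eq_zero (ν := ν) hη hθ hz
    rw [h0, h1]; simp
  have h := le_integral_of_box (k := lp) hR.le hS.le hi (fun z => by positivity) (fun z hz => ?_)
  · rw [quartic]
    linarith
  · rw [norm_wavePacket_eq_one hη hθ hz]
    have h1 : 0 ≤ lm * ‖wavePacketSnd ν hη hθ z‖ ^ 4 := by positivity
    have h2 : 0 ≤ 2 * l0 * (1 : ℝ) ^ 2 * ‖wavePacketSnd ν hη hθ z‖ ^ 2 := by positivity
    linarith

end WavePacketEstimates

/-- On a box of scales `R = n²` and `S = n` the longitudinal error `1/R` and the transverse error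
`1/S²` balance at `n⁻²`. Defect times mass is `O(n⁻⁴ · n³ · n³) = O(n²)`, against a quartic term of
order at least `n³`. -/
theorem infEnergy_lt_infEnergyLin {ν lp lm l0 ρ : ℝ} (hν : 0 < ν) (hlp : 0 < lp)
    (hlm : 0 < lm) (hl0 : 0 < l0) (hρ : 0 < ρ) :
    infEnergy ν lp lm l0 ρ < infEnergyLin ν ρ := by
  obtain ⟨B, hB, hcut⟩ := exists_isCutoff
  -- For `n ≥ 1`, `K` bounds the second component and `D / n²` bounds the pointwise defect.
  set K := ν⁻¹ * (ν + B + B)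
  set D := ν⁻¹ * (2 * ν * B + B + B)
  -- The threshold is what `256 D² (1 + K²) n² < 4 lp n³ ρ` requires.
  obtain ⟨n, hn1, hn⟩ : ∃ n : ℝ, 1 ≤ n ∧ 64 * D ^ 2 * (1 + K ^ 2) / (lp * ρ) < n :=
    ⟨max 1 (64 * D ^ 2 * (1 + K ^ 2) / (lp * ρ) + 1), le_max_left _ _,
      lt_max_of_lt_right (lt_add_one _)⟩
  have hn0 : 0 < n := by linarith
  obtain ⟨η, η₁, η₂, hη⟩ := hcut (n ^ 2) (by positivity)
  obtain ⟨θ, θ₁, θ₂, hθ⟩ := hcut n hn0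
  have hn2 : 1 ≤ n ^ 2 := one_le_pow₀ hn1
  have hmass : mass (wavePacket ν hη hθ) (wavePacketSnd ν hη hθ)
      ≤ (1 + K ^ 2) * (16 * n ^ 2 * n) := by
    refine (mass_wavePacket_le hν (by positivity) hn0 hη hθ).trans ?_
    have h1 : B / n ^ 2 ≤ B := div_le_self hB.le hn2
    have h2 : B / n ≤ B := div_le_self hB.le hn1
    simp only [K]
    gcongr
  have hdefect : defect ν (wavePacket ν hη hθ) (wavePacketSnd ν hη hθ)
      ≤ (D / n ^ 2) ^ 2 * (16 * n ^ 2 * n) := by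
    refine (defect_wavePacket_le hν (by positivity) hn0 hη hθ).trans ?_
    have h1 : B / (n ^ 2) ^ 2 ≤ B / n ^ 2 :=
      div_le_div_of_nonneg_left hB.le (by positivity) (le_self_pow₀ hn2 two_ne_zero)
    have h2 : D / n ^ 2 = ν⁻¹ * (2 * ν * (B / n ^ 2) + B / n ^ 2 + B / n ^ 2) := by
      simp only [D]; ring
    rw [h2]
    gcongr
  have hpos := mass_wavePacket_pos (ν := ν) (by positivity) hn0 hη hθ
  refine infEnergy_lt_of_defect_mul_mass_lt hρ _ _ hpos ?_
  refine lt_of_le_of_lt (mul_le_mul hdefect hmass hpos.le (by positivity)) ?_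
  refine lt_of_lt_of_le ?_ (mul_le_mul_of_nonneg_right
    (le_quartic_wavePacket (by positivity) hn0 hη hθ hlp hlm hl0) hρ.le)
  rw [div_lt_iff₀ (by positivity)] at hn
  calc (D / n ^ 2) ^ 2 * (16 * n ^ 2 * n) * ((1 + K ^ 2) * (16 * n ^ 2 * n))
      = 4 * n ^ 2 * (64 * D ^ 2 * (1 + K ^ 2)) := by field_simp; ring
    _ < 4 * n ^ 2 * (n * (lp * ρ)) := mul_lt_mul_of_pos_left hn (by positivity)
    _ = lp * (4 * n ^ 2 * n) * ρ := by ring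

end SpinOrbit

theorem lemma2p3 (ν lp lm l0 : ℝ) (hν : 0 < ν) (hlp : 0 < lp) (hlm : 0 < lm) (hl0 : 0 < l0)
    (ρ : ℝ) (hρ : 0 < ρ) :
    SpinOrbit.infEnergy ν lp lm l0 ρ < SpinOrbit.infEnergyLin ν ρ ∧
      ∀ m : ℤ, SpinOrbit.infEnergyRad m ν lp lm l0 ρ < SpinOrbit.infEnergyLinRad m ν ρ :=
  ⟨SpinOrbit.infEnergy_lt_infEnergyLin hν hlp hlm hl0 hρ,
    SpinOrbit.infEnergyRad_lt_infEnergyLinRad hν hlp hlm hl0 hρ⟩
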